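/- Let $G$ be a compact abelian group with normalized Haar measure $\mu$, and let $\Lambda$ be a set of (continuous, unimodular) characters of $G$. For measurable $f:G\to\mathbb C$ write $$\|f\|_{\psi_2}=\inf\Big\{K>0:\int_G \big(e^{|f|^2/K^2}-1\big)\,d\mu\le 1\Big\}.$$ For every $C$ there is a constant $\gamma=\gamma(C)>0$, depending only on $C$ (and not on $G$ or $\Lambda$), such that the following holds. Suppose that $\Lambda$ satisfies the $\psi_2(C)$ condition $$\Big\|\sum_{\chi\in\Lambda}a_\chi\chi\Big\|_{\psi_2}\le C\Big(\sum_{\chi\in\Lambda}|a_\chi|^2\Big)^{1/2}\qquad\text{for all finitely supported complex }(a_\chi)_{\chi\in\Lambda},$$ or that $\Lambda$ satisfies Rudin's condition $$\Big\|\sum_{\chi\in\Lambda}a_\chi\chi\Big\|_{L^p(\mu)}\le C\sqrt p\,\Big(\sum_{\chi\in\Lambda}|a_\chi|^2\Big)^{1/2}\qquad\text{for all } p>2\text{ and all finitely supported complex }(a_\chi)_{\chi\in\Lambda}.$$ Then $\Lambda$ is a Sidon set with constant $\gamma$: $$\sup_{x\in G}\Big|\sum_{\chi\in\Lambda}a_\chi\chi(x)\Big|\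 \ge\ \gamma\sum_{\chi\in\Lambda}|a_\chi|\qquad\text{for all finitely supported complex }(a_\chi)_{\chi\in\Lambda}.$$ -/

import Mathlib

open MeasureTheory
open scoped ENNReal NNReal

/-- The Orlicz (Luxemburg) norm attached to `ψ₂(x) = exp (|x|²) - 1`: the infimum of all `K > 0`
with `∫ ψ₂(|f| / K) dμ ≤ 1` (it is `∞` if there is no such `K`). -/
noncomputable def psi2Norm {Ω : Type*} [MeasurableSpace Ω] (f : Ω → ℂ) (μ : Measure Ω) : ℝ≥0∞ :=
  ⨅ (K : ℝ≥0) (_ : 0 < K)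
    (_ : ∫⁻ x, ENNReal.ofReal (Real.exp ((‖f x‖ / (K : ℝ)) ^ 2) - 1) ∂μ ≤ 1), (K : ℝ≥0∞)

/-- The `ψ₂(C)` condition for a system of functions:
`‖∑ a_j φ_j‖_{ψ₂} ≤ C (∑ |a_j|²)^{1/2}` for all finite systems of complex coefficients. -/
def Psi2Condition {ι Ω : Type*} [MeasurableSpace Ω] (φ : ι → Ω → ℂ) (μ : Measure Ω) (C : ℝ) :
    Prop :=
  ∀ (s : Finset ι) (a : ι → ℂ),
    psi2Norm (fun x => ∑ j ∈ s, a j * φ j x) μ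
      ≤ ENNReal.ofReal (C * Real.sqrt (∑ j ∈ s, ‖a j‖ ^ 2))

/-- Rudin's condition `M_p ≤ C √p`: for every `p > 2`,
`‖∑ a_j φ_j‖_{L^p} ≤ C √p (∑ |a_j|²)^{1/2}` for all finite systems of complex coefficients. -/
def RudinCondition {ι Ω : Type*} [MeasurableSpace Ω] (φ : ι → Ω → ℂ) (μ : Measure Ω) (C : ℝ) :
    Prop :=
  ∀ p : ℝ, 2 < p → ∀ (s : Finset ι) (a : ι → ℂ),
    eLpNorm (fun x => ∑ j ∈ s, a j * φ j x) (ENNReal.ofReal p) μ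
      ≤ ENNReal.ofReal (C * Real.sqrt p * Real.sqrt (∑ j ∈ s, ‖a j‖ ^ 2))

/-- A system of functions is Sidon with constant `γ` if
`γ ∑ |a_j| ≤ sup_x |∑ a_j φ_j(x)|` for all finite systems of complex coefficients. -/
def SidonWith {ι Ω : Type*} (φ : ι → Ω → ℂ) (γ : ℝ) : Prop :=
  ∀ (s : Finset ι) (a : ι → ℂ),
    ENNReal.ofReal (γ * ∑ j ∈ s, ‖a j‖) ≤ ⨆ x : Ω, ‖∑ j ∈ s, a j * φ j x‖ₑ

/-- A set `Λ` of characters of `G`, regarded as a system of complex functions on `G`. -/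
noncomputable def characterSystem {G : Type*} [CommGroup G] [TopologicalSpace G]
    (Λ : Set (PontryaginDual G)) : Λ → G → ℂ :=
  fun χ x => ((χ : PontryaginDual G) x : ℂ)

open scoped BigOperators

/-! Both hypotheses say that the characters in Λ are subgaussian. With N² = ∑ |c_i|² and C replaced
by max C 1, either one gives ∫ exp(|f|² / (6CN)²) ≤ 2 for f = ∑ c_i χ_i, hence ∫ exp(Re f) ≤ 2 exp(D
N²) with D = (6C)² / 4 (`integral_exp_re_le_of_exp_sq`). From there the proof passes through random
signs, in two moves.

The first move (`sum_norm_le_expect_supNorm`) uses no group structure: a subgaussian system of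
unimodular functions satisfies ∑ |a_i| ≤ K 𝔼 sup |∑ ω_i a_i φ_i|. By the contraction principle the
moduli of the coefficients may be taken constant on blocks of geometrically growing size. For one
block of real functions g_j with signs ω, restrict the measure to a set B and tilt it by the Riesz
product ∏ (1 + β ω_j g_j). Averaged over ω_j, the tilted mean of ω_j g_j is about β times the
variance of g_j. The second moments add up to n, half the number of the g_j, because these are the
real and imaginary parts of unimodular functions. The squared means add up to a small fraction of n,
because the Gibbs inequality confronts the low entropy of the tilt with the subgaussian bound,
provided B is not too small. So the signed block sum has average tilted mean of order n / D, and it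
nearly reaches its tilted mean on a part of B of measure at least exp(-5n). The next block is so
much longer that this part is again an admissible B, and the gains of all blocks add up at a common
point (`expect_sSup_blocks_ge`).

The second move is Rider's theorem (`sum_norm_le_supNorm_of_expect`). By Hahn–Banach, the Rademacher
estimate yields a function v from the cube to the polar ball of the sup norm such that the m-th
coordinate of v has Walsh coefficient c at {m}. For characters the polar ball is closed under
pointwise products, so averaging v(ω) v(ω') against a Riesz kernel stays in it and produces ∑_S r^S
v̂_m(S)². Four such kernels combine into one that kills S = ∅, has arbitrary complex multipliers of
size ρ / 2 on singletons, and is O(ρ²) on larger S. The unknown coefficients v̂_m({k}) with k ≠ m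
disappear after translating by y and integrating over G, by orthogonality of characters. For small ρ
the main term ρ c² / 2 beats the error ρ². -/

/-- The sign `±1` attached to a Boolean. -/
def boolSign (b : Bool) : ℝ := if b then 1 else -1

lemma boolSign_mul_self (b : Bool) : boolSign b * boolSign b = 1 := by
  cases b <;> simp [boolSign]

lemma boolSign_not (b : Bool) : boolSign (!b) = -boolSign b := by
  cases b <;> simp [boolSign]

lemma abs_boolSign (b : Bool) : |boolSign b| = 1 := by
  cases b <;> simp [boolSign]

lemma boolSign_xor (b c : Bool) : boolSign (b ^^ c) = -(boolSign b * boolSign c) := by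
  cases b <;> cases c <;> simp [boolSign]

lemma boolSign_eq_or (b : Bool) : boolSign b = 1 ∨ boolSign b = -1 := by
  cases b <;> simp [boolSign]

/-! ### Averages over the discrete cube and the contraction principle. -/

section Cube

variable {J : Type*} [Fintype J] [DecidableEq J]

/-- Flip one coordinate of a point of the discrete cube. -/
def flipAt (j : J) (ω : J → Bool) : J → Bool := Function.update ω j (!ω j)

omit [Fintype J] in
lemma flipAt_self (j : J) (ω : J → Bool) : flipAt j ω j = !ω j := by simp [flipAt]

omit [Fintype J] in
lemma flipAt_of_ne {i j : J} (h : i ≠ j) (ω : J → Bool) : flipAt j ω i = ω i := by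
  simp [flipAt, h]

omit [Fintype J] in
lemma flipAt_involutive (j : J) : Function.Involutive (flipAt (J := J) j) := by
  intro ω
  ext i
  by_cases h : i = j
  · subst h; simp [flipAt_self]
  · simp [flipAt_of_ne h]

lemma expect_flipAt {E : Type*} [AddCommMonoid E] [Module ℚ≥0 E] (j : J) (F : (J → Bool) → E) :
    𝔼 ω, F (flipAt j ω) = 𝔼 ω, F ω :=
  Fintype.expect_equiv (flipAt_involutive j).toPerm _ _ fun _ => rfl

lemma expect_eq_half (j : J) (F : (J → Bool) → ℝ) :
    𝔼 ω, F ω = 𝔼 ω, (F ω + F (flipAt j ω)) / 2 := by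
  rw [← Finset.expect_div, Finset.expect_add_distrib, expect_flipAt]
  ring

lemma expect_boolSign (j : J) : 𝔼 ω : J → Bool, boolSign (ω j) = 0 := by
  rw [expect_eq_half j]
  simp [flipAt_self, boolSign_not]

/-- Exchanging the coordinates outside A between two independent uniform sign vectors preserves
their joint law. It serves to freeze the signs of one block while the others are averaged. -/
lemma expect_piecewise (A : Finset J) (F : (J → Bool) → ℝ) :
    𝔼 η, 𝔼 ω, F (A.piecewise η ω) = 𝔼 ω, F ω := by
  have hinv : Function.Involutive
      (fun p : (J → Bool) × (J → Bool) => (A.piecewise p.1 p.2, A.piecewise p.2 p.1)) := by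
    rintro ⟨η, ω⟩
    ext i <;> by_cases h : i ∈ A <;> simp [h]
  have h1 : 𝔼 p : (J → Bool) × (J → Bool), F (A.piecewise p.1 p.2)
      = 𝔼 p : (J → Bool) × (J → Bool), F p.1 :=
    Fintype.expect_equiv hinv.toPerm _ _ fun _ => rfl
  have h2 : ∀ f : (J → Bool) → (J → Bool) → ℝ,
      𝔼 p : (J → Bool) × (J → Bool), f p.1 p.2 = 𝔼 η, 𝔼 ω, f η ω := fun f =>
    Finset.expect_product _ _ (fun p : (J → Bool) × (J → Bool) => f p.1 p.2)
  rw [h2 (fun η ω => F (A.piecewise η ω)), h2 (fun η _ => F η)] at h1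
  rw [h1]
  simp

lemma expect_xor (ξ : J → Bool) (F : (J → Bool) → ℝ) :
    𝔼 ω : J → Bool, F (fun j => ω j ^^ ξ j) = 𝔼 ω, F ω := by
  have hinv : Function.Involutive (fun (ω : J → Bool) (j : J) => ω j ^^ ξ j) := by
    intro ω; ext j; simp
  exact Fintype.expect_equiv hinv.toPerm _ _ fun _ => rfl

lemma sum_cube_prod (f : J → Bool → ℝ) :
    ∑ ω : J → Bool, ∏ j, f j (ω j) = ∏ j, (f j true + f j false) := by
  have := Finset.prod_univ_sum (fun _ : J => (Finset.univ : Finset Bool)) f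
  simp only [Fintype.piFinset_univ, Fintype.sum_bool] at this
  exact this.symm

/-- The weights of the product probability on the cube whose mean is `θ`. -/
noncomputable def cubeWeight (θ : J → ℝ) (ξ : J → Bool) : ℝ := ∏ j, ((1 + θ j * boolSign (ξ j)) / 2)

omit [DecidableEq J] in
lemma cubeWeight_nonneg {θ : J → ℝ} (hθ : ∀ j, |θ j| ≤ 1) (ξ : J → Bool) :
    0 ≤ cubeWeight θ ξ := by
  refine Finset.prod_nonneg fun j _ => ?_
  have := abs_le.1 (hθ j)
  rcases boolSign_eq_or (ξ j) with h | h <;> rw [h] <;> linarith [this.1, this.2]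

lemma sum_cubeWeight (θ : J → ℝ) : ∑ ξ, cubeWeight θ ξ = 1 := by
  unfold cubeWeight
  rw [sum_cube_prod (fun j b => (1 + θ j * boolSign b) / 2)]
  refine Finset.prod_eq_one fun j _ => ?_
  simp [boolSign]; ring

lemma sum_cubeWeight_mul (θ : J → ℝ) (i : J) :
    ∑ ξ, cubeWeight θ ξ * boolSign (ξ i) = θ i := by
  have h : ∀ ξ : J → Bool, cubeWeight θ ξ * boolSign (ξ i) =
      ∏ j, ((1 + θ j * boolSign (ξ j)) / 2 * if j = i then boolSign (ξ j) else 1) := by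
    intro ξ
    rw [Finset.prod_mul_distrib, Finset.prod_ite_eq' Finset.univ i]
    simp [cubeWeight]
  simp_rw [h]
  rw [sum_cube_prod (fun j b => (1 + θ j * boolSign b) / 2 * if j = i then boolSign b else 1)]
  rw [Finset.prod_eq_single i]
  · simp [boolSign]; ring
  · intro j _ hj
    simp [boolSign, hj]; ring
  · simp

/-- The contraction principle for Rademacher averages of a convex function. -/
lemma expect_contraction {Ψ : (J → ℝ) → ℝ} (hΨ : ConvexOn ℝ Set.univ Ψ) {θ : J → ℝ}
    (hθ : ∀ j, |θ j| ≤ 1) :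
    𝔼 ω : J → Bool, Ψ (fun j => boolSign (ω j) * θ j) ≤
      𝔼 ω : J → Bool, Ψ (fun j => boolSign (ω j)) := by
  have hθ' : ∀ j, |-θ j| ≤ 1 := fun j => by rw [abs_neg]; exact hθ j
  -- Under `boolSign`, xor is multiplication up to a factor -1. Hence ξ is drawn with mean -θ: then
  -- ω_j θ_j is the mean of the sign of ω_j xor ξ_j, and Jensen applies.
  have key : ∀ ω : J → Bool, Ψ (fun j => boolSign (ω j) * θ j) ≤
      ∑ ξ, cubeWeight (fun j => -θ j) ξ * Ψ (fun j => boolSign (ω j ^^ ξ j)) := by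
    intro ω
    have h := hΨ.map_sum_le (t := Finset.univ) (w := cubeWeight (fun j => -θ j))
      (p := fun ξ j => boolSign (ω j ^^ ξ j))
      (fun ξ _ => cubeWeight_nonneg hθ' ξ) (sum_cubeWeight _) (fun _ _ => Set.mem_univ _)
    refine le_trans (le_of_eq ?_) h
    congr 1
    ext j
    simp only [Finset.sum_apply, Pi.smul_apply, smul_eq_mul, boolSign_xor]
    have := sum_cubeWeight_mul (fun j => -θ j) j
    calc boolSign (ω j) * θ j = -boolSign (ω j) * -θ j := by ring
      _ = -boolSign (ω j) * ∑ ξ, cubeWeight (fun j => -θ j) ξ * boolSign (ξ j) := by rw [this]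
      _ = _ := by rw [Finset.mul_sum]; exact Finset.sum_congr rfl fun ξ _ => by ring
  calc _ ≤ 𝔼 ω : J → Bool,
        ∑ ξ, cubeWeight (fun j => -θ j) ξ * Ψ (fun j => boolSign (ω j ^^ ξ j)) :=
        Finset.expect_le_expect fun ω _ => key ω
    _ = ∑ ξ, cubeWeight (fun j => -θ j) ξ * 𝔼 ω : J → Bool, Ψ (fun j => boolSign (ω j)) := by
        rw [Finset.expect_sum_comm]
        refine Finset.sum_congr rfl fun ξ _ => ?_
        rw [← Finset.mul_expect]
        congr 1
        exact expect_xor ξ (fun ω => Ψ (fun j => boolSign (ω j)))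
    _ = _ := by rw [← Finset.sum_mul, sum_cubeWeight, one_mul]

end Cube

lemma expect_sum_cube {ι : Type*} [Fintype ι] [DecidableEq ι] (F : (ι ⊕ ι → Bool) → ℝ) :
    𝔼 ω, F ω = 𝔼 η : ι → Bool, 𝔼 η' : ι → Bool, F (Sum.elim η η') := by
  have h2 := Finset.expect_product (Finset.univ : Finset (ι → Bool)) (Finset.univ : Finset (ι → Bool))
    (fun p => F (Sum.elim p.1 p.2))
  rw [← h2]
  exact Fintype.expect_equiv (Equiv.sumArrowEquivProdArrow ι ι Bool) _ _ fun ω => by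
    congr 1; ext (i | i) <;> rfl

/-! ### Bounded measurable functions, for integrability. -/

/-- Bounded measurable real functions. -/
def BddMeas {Ω : Type*} [MeasurableSpace Ω] (f : Ω → ℝ) : Prop :=
  Measurable f ∧ ∃ M, ∀ x, |f x| ≤ M

namespace BddMeas

variable {Ω : Type*} [MeasurableSpace Ω] {f g : Ω → ℝ}

lemma const (a : ℝ) : BddMeas (fun _ : Ω => a) := ⟨measurable_const, |a|, fun _ => le_rfl⟩

lemma add (hf : BddMeas f) (hg : BddMeas g) : BddMeas (fun x => f x + g x) := by
  obtain ⟨hf, M, hM⟩ := hf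
  obtain ⟨hg, N, hN⟩ := hg
  exact ⟨hf.add hg, M + N, fun x => (abs_add_le _ _).trans (add_le_add (hM x) (hN x))⟩

lemma mul (hf : BddMeas f) (hg : BddMeas g) : BddMeas (fun x => f x * g x) := by
  obtain ⟨hf, M, hM⟩ := hf
  obtain ⟨hg, N, hN⟩ := hg
  refine ⟨hf.mul hg, M * N, fun x => ?_⟩
  rw [abs_mul]
  exact mul_le_mul (hM x) (hN x) (abs_nonneg _) ((abs_nonneg _).trans (hM x))

lemma const_mul (a : ℝ) (hf : BddMeas f) : BddMeas (fun x => a * f x) := (const a).mul hf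

lemma sub (hf : BddMeas f) (hg : BddMeas g) : BddMeas (fun x => f x - g x) := by
  simpa [sub_eq_add_neg] using hf.add (hg.const_mul (-1))

lemma pow (hf : BddMeas f) (n : ℕ) : BddMeas (fun x => f x ^ n) := by
  induction n with
  | zero => simpa using const 1
  | succ n ih => simpa [pow_succ] using ih.mul hf

lemma sum {J : Type*} {s : Finset J} {f : J → Ω → ℝ} (hf : ∀ j ∈ s, BddMeas (f j)) :
    BddMeas (fun x => ∑ j ∈ s, f j x) := by
  classical
  induction s using Finset.induction_on with
  | empty => simpa using const 0
  | insert a s ha ih =>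
    simp_rw [Finset.sum_insert ha]
    exact (hf a (by simp)).add (ih fun j hj => hf j (by simp [hj]))

lemma prod {J : Type*} {s : Finset J} {f : J → Ω → ℝ} (hf : ∀ j ∈ s, BddMeas (f j)) :
    BddMeas (fun x => ∏ j ∈ s, f j x) := by
  classical
  induction s using Finset.induction_on with
  | empty => simpa using const 1
  | insert a s ha ih =>
    simp_rw [Finset.prod_insert ha]
    exact (hf a (by simp)).mul (ih fun j hj => hf j (by simp [hj]))

lemma exp (hf : BddMeas f) : BddMeas (fun x => Real.exp (f x)) := by
  obtain ⟨hf, M, hM⟩ := hf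
  refine ⟨hf.exp, Real.exp M, fun x => ?_⟩
  rw [Real.abs_exp]
  exact Real.exp_le_exp.2 ((le_abs_self _).trans (hM x))

lemma integrable (hf : BddMeas f) (ν : Measure Ω) [IsFiniteMeasure ν] : Integrable f ν := by
  obtain ⟨hf, M, hM⟩ := hf
  exact Integrable.of_bound hf.aestronglyMeasurable M (Filter.Eventually.of_forall hM)

end BddMeas

/-! ### Tilted means and the flip of one sign. -/

/-- Here x and y play the first and second moments of u before the factor 1 + βσu is inserted, and q
the second moment after. The half sum equals β (y - x²) / (1 - β² x²), essentially β times the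
variance. The lower bound is rewritten with the moments after tilting, since these are the ones that
can be summed over a block. -/
lemma tilt_flip_algebra {x y q β σ : ℝ} (hσ : σ = 1 ∨ σ = -1) (hβ : 0 < β) (hβ1 : β ≤ 1 / 10)
    (hx : |x| ≤ 1) (hxy : x ^ 2 ≤ y) (hy : y ≤ 1) (hq : q ≤ (1 + β) * y / (1 + β * σ * x)) :
    (σ * ((x + β * σ * y) / (1 + β * σ * x)) + -σ * ((x + β * -σ * y) / (1 + β * -σ * x))) / 2
      ≤ 2 * β ∧
    β * (q / 3 - 2 * ((x + β * σ * y) / (1 + β * σ * x)) ^ 2 - 8 * β ^ 2) ≤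
    (σ * ((x + β * σ * y) / (1 + β * σ * x)) + -σ * ((x + β * -σ * y) / (1 + β * -σ * x))) / 2 := by
  obtain ⟨hx1, hx2⟩ := abs_le.1 hx
  have hs2 : σ ^ 2 = 1 := by rcases hσ with h | h <;> rw [h] <;> norm_num
  have hbx : |β * σ * x| ≤ 1 / 10 := by
    rw [abs_mul, abs_mul, abs_of_pos hβ]
    have : |σ| = 1 := by rcases hσ with h | h <;> rw [h] <;> norm_num
    rw [this]; nlinarith [abs_nonneg x]
  obtain ⟨h1, h2⟩ := abs_le.1 hbx
  have hp : 0 < 1 + β * σ * x := by linarith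
  have hm : 0 < 1 + β * -σ * x := by linarith
  have hy0 : 0 ≤ y := (sq_nonneg x).trans hxy
  have hd : 0 < 1 - β ^ 2 * x ^ 2 := by
    have : (1 + β * σ * x) * (1 + β * -σ * x) = 1 - β ^ 2 * x ^ 2 := by
      linear_combination (-(β ^ 2 * x ^ 2)) * hs2
    rw [← this]; positivity
  have havg : (σ * ((x + β * σ * y) / (1 + β * σ * x)) +
      -σ * ((x + β * -σ * y) / (1 + β * -σ * x))) / 2 = β * (y - x ^ 2) / (1 - β ^ 2 * x ^ 2) := by
    have h : ∀ P M N₁ N₂ : ℝ, P ≠ 0 → M ≠ 0 →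
        (σ * (N₁ / P) + -σ * (N₂ / M)) / 2 = σ * (N₁ * M - N₂ * P) / (2 * (P * M)) := by
      intro P M N₁ N₂ hP hM
      field_simp
      ring
    rw [h _ _ _ _ hp.ne' hm.ne', div_eq_div_iff (by positivity) hd.ne']
    linear_combination 2 * β * (y - x ^ 2) * hs2
  rw [havg]
  have hβ2 : β ^ 2 ≤ 1 / 100 := by nlinarith
  have hx2' : x ^ 2 ≤ 1 := by nlinarith
  have hd2 : (1 : ℝ) / 2 ≤ 1 - β ^ 2 * x ^ 2 := by nlinarith [sq_nonneg x, sq_nonneg β]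
  constructor
  · rw [div_le_iff₀ hd]; nlinarith [sq_nonneg x]
  · have hlow : β * (y - x ^ 2) ≤ β * (y - x ^ 2) / (1 - β ^ 2 * x ^ 2) := by
      rw [le_div_iff₀ hd]
      have : 0 ≤ β * (y - x ^ 2) := mul_nonneg hβ.le (by linarith)
      nlinarith [sq_nonneg (β * x)]
    refine le_trans ?_ hlow
    refine mul_le_mul_of_nonneg_left ?_ hβ.le
    have hq3 : q / 3 ≤ y := by
      have : (1 + β) * y / (1 + β * σ * x) ≤ 3 * y := by
        rw [div_le_iff₀ hp]; nlinarith
      linarith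
    set b := (x + β * σ * y) / (1 + β * σ * x) with hb
    -- One factor moves the mean by at most 2β, so x² ≤ 2b² + 2(b - x)² ≤ 2b² + 8β².
    have hbx' : (b - x) ^ 2 ≤ (2 * β) ^ 2 := by
      have : b - x = β * σ * (y - x ^ 2) / (1 + β * σ * x) := by
        rw [eq_div_iff hp.ne', sub_mul, hb, div_mul_cancel₀ _ hp.ne']; ring
      rw [this, div_pow, div_le_iff₀ (by positivity)]
      have e1 : (β * σ * (y - x ^ 2)) ^ 2 = β ^ 2 * (y - x ^ 2) ^ 2 := by
        linear_combination (β ^ 2 * (y - x ^ 2) ^ 2) * hs2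
      rw [e1]
      have e2 : (y - x ^ 2) ^ 2 ≤ 1 := by
        have : 0 ≤ y - x ^ 2 := by linarith
        have : y - x ^ 2 ≤ 1 := by linarith [sq_nonneg x]
        nlinarith
      have e3 : (1 : ℝ) / 4 ≤ (1 + β * σ * x) ^ 2 := by nlinarith
      nlinarith [sq_nonneg β]
    nlinarith [sq_nonneg (2 * b - x)]

lemma tilt_flip {Ω : Type*} [MeasurableSpace Ω] (ν : Measure Ω) [IsFiniteMeasure ν]
    {V u : Ω → ℝ} (hV : BddMeas V) (hu : BddMeas u) (hV0 : ∀ x, 0 ≤ V x) (hu1 : ∀ x, |u x| ≤ 1)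
    (hVpos : 0 < ∫ x, V x ∂ν) {β σ : ℝ} (hσ : σ = 1 ∨ σ = -1) (hβ : 0 < β) (hβ1 : β ≤ 1 / 10) :
    (σ * ((∫ x, u x * ((1 + β * σ * u x) * V x) ∂ν) / ∫ x, (1 + β * σ * u x) * V x ∂ν) +
      -σ * ((∫ x, u x * ((1 + β * -σ * u x) * V x) ∂ν) / ∫ x, (1 + β * -σ * u x) * V x ∂ν)) / 2
      ≤ 2 * β ∧
    β * ((∫ x, u x ^ 2 * ((1 + β * σ * u x) * V x) ∂ν) / (∫ x, (1 + β * σ * u x) * V x ∂ν) / 3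
        - 2 * ((∫ x, u x * ((1 + β * σ * u x) * V x) ∂ν) /
            ∫ x, (1 + β * σ * u x) * V x ∂ν) ^ 2 - 8 * β ^ 2) ≤
    (σ * ((∫ x, u x * ((1 + β * σ * u x) * V x) ∂ν) / ∫ x, (1 + β * σ * u x) * V x ∂ν) +
      -σ * ((∫ x, u x * ((1 + β * -σ * u x) * V x) ∂ν) / ∫ x, (1 + β * -σ * u x) * V x ∂ν)) / 2 := by
  set X := ∫ x, V x ∂ν with hX
  set X1 := ∫ x, u x * V x ∂ν with hX1
  set X2 := ∫ x, u x ^ 2 * V x ∂ν with hX2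
  have hi1 := (hu.mul hV).integrable ν
  have hi2 := ((hu.pow 2).mul hV).integrable ν
  have hi0 := hV.integrable ν
  have hZ : ∀ s : ℝ, ∫ x, (1 + β * s * u x) * V x ∂ν = X + β * s * X1 := by
    intro s
    rw [hX, hX1, ← integral_const_mul, ← integral_add hi0 (hi1.const_mul _)]
    exact integral_congr_ae (Filter.Eventually.of_forall fun x => by simp only; ring)
  have hN : ∀ s : ℝ, ∫ x, u x * ((1 + β * s * u x) * V x) ∂ν = X1 + β * s * X2 := by
    intro s
    rw [hX1, hX2, ← integral_const_mul, ← integral_add hi1 (hi2.const_mul _)]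
    exact integral_congr_ae (Filter.Eventually.of_forall fun x => by simp only; ring)
  have hu2 : ∀ x, u x ^ 2 ≤ 1 := fun x => by
    have := abs_le.1 (hu1 x); nlinarith
  have hσβ : ∀ x, β * σ * u x ≤ β := fun x => by
    have := abs_le.1 (hu1 x)
    rcases hσ with h | h <;> rw [h] <;> nlinarith
  have hQ : ∫ x, u x ^ 2 * ((1 + β * σ * u x) * V x) ∂ν ≤ (1 + β) * X2 := by
    rw [hX2, ← integral_const_mul]
    refine integral_mono ?_ (hi2.const_mul _) fun x => ?_
    · exact ((hu.pow 2).mul (((BddMeas.const 1).add (hu.const_mul _)).mul hV)).integrable ν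
    · have := mul_nonneg (sq_nonneg (u x)) (hV0 x)
      simp only
      nlinarith [hσβ x]
  have hX1X : |X1| ≤ X := by
    rw [abs_le]
    constructor
    · rw [hX, hX1, ← integral_neg]
      exact integral_mono hi0.neg hi1 fun x => by
        have := abs_le.1 (hu1 x); simp only; nlinarith [hV0 x]
    · exact integral_mono hi1 hi0 fun x => by
        have := abs_le.1 (hu1 x); simp only; nlinarith [hV0 x]
  have hX2X : X2 ≤ X := integral_mono hi2 hi0 fun x => by
    simp only; nlinarith [hV0 x, hu2 x]
  have hCS : X1 ^ 2 ≤ X * X2 := by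
    have h0 : 0 ≤ ∫ x, (X * u x - X1) ^ 2 * V x ∂ν :=
      integral_nonneg fun x => mul_nonneg (sq_nonneg _) (hV0 x)
    have h1 : ∫ x, (X * u x - X1) ^ 2 * V x ∂ν = X * (X * X2 - X1 ^ 2) := by
      have : ∀ x, (X * u x - X1) ^ 2 * V x =
          X ^ 2 * (u x ^ 2 * V x) + (-2 * X * X1) * (u x * V x) + X1 ^ 2 * V x := fun x => by ring
      simp_rw [this]
      have hi21 : Integrable (fun x => X ^ 2 * (u x ^ 2 * V x) + (-2 * X * X1) * (u x * V x)) ν :=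
        (hi2.const_mul _).add (hi1.const_mul _)
      rw [integral_add hi21 (hi0.const_mul _),
        integral_add (hi2.const_mul _) (hi1.const_mul _), integral_const_mul, integral_const_mul,
        integral_const_mul]
      ring
    rw [h1] at h0
    nlinarith [(mul_nonneg_iff_of_pos_left hVpos).1 h0]
  have hn : ∀ s, (X1 + β * s * X2) / (X + β * s * X1) =
      (X1 / X + β * s * (X2 / X)) / (1 + β * s * (X1 / X)) := by
    intro s
    have hX0 : X ≠ 0 := hVpos.ne'
    have h1 : X + β * s * X1 = X * (1 + β * s * (X1 / X)) := by field_simp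
    have h2 : X1 + β * s * X2 = X * (X1 / X + β * s * (X2 / X)) := by field_simp
    calc (X1 + β * s * X2) / (X + β * s * X1)
        = X * (X1 / X + β * s * (X2 / X)) / (X * (1 + β * s * (X1 / X))) := by rw [← h1, ← h2]
      _ = _ := mul_div_mul_left _ _ hX0
  have hposden : 0 < X + β * σ * X1 := by
    have : |β * σ * X1| ≤ X / 10 := by
      rw [abs_mul, abs_mul, abs_of_pos hβ]
      have : |σ| = 1 := by rcases hσ with h | h <;> rw [h] <;> norm_num
      rw [this]; nlinarith [abs_nonneg X1]
    have := (abs_le.1 this).1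
    linarith
  simp_rw [hZ, hN]
  have key := tilt_flip_algebra (x := X1 / X) (y := X2 / X)
    (q := (∫ x, u x ^ 2 * ((1 + β * σ * u x) * V x) ∂ν) / (X + β * σ * X1)) hσ hβ hβ1
    (by rw [abs_div, abs_of_pos hVpos]; exact (div_le_one hVpos).2 hX1X)
    (by rw [div_pow, div_le_div_iff₀ (by positivity) hVpos]; nlinarith)
    ((div_le_one hVpos).2 hX2X)
    (by
      have : (1 + β) * (X2 / X) / (1 + β * σ * (X1 / X)) = (1 + β) * X2 / (X + β * σ * X1) := by
        have h1 : 1 + β * σ * (X1 / X) = (X + β * σ * X1) / X := by field_simp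
        rw [h1]; field_simp
      rw [this]
      exact div_le_div_of_nonneg_right hQ hposden.le)
  simp_rw [hn]
  exact key

/-- The Gibbs variational inequality, in exponential form. -/
lemma mul_exp_div_le_integral {Ω : Type*} [MeasurableSpace Ω] (ν : Measure Ω) [IsFiniteMeasure ν]
    {w k : Ω → ℝ} (hw : BddMeas w) (hk : BddMeas k) (hw0 : ∀ x, 0 ≤ w x)
    (hpos : 0 < ∫ x, w x ∂ν) :
    (∫ x, w x ∂ν) * Real.exp ((∫ x, k x * w x ∂ν) / ∫ x, w x ∂ν) ≤ ∫ x, Real.exp (k x) * w x ∂ν := by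
  set Z := ∫ x, w x ∂ν with hZ
  set t := (∫ x, k x * w x ∂ν) / Z with ht
  have htZ : ∫ x, k x * w x ∂ν = t * Z := by rw [ht]; field_simp
  have hikw := (hk.mul hw).integrable ν
  have hiw := hw.integrable ν
  have h1 : ∫ x, (Real.exp t * (1 - t) * w x + Real.exp t * (k x * w x)) ∂ν
      ≤ ∫ x, Real.exp (k x) * w x ∂ν := by
    refine integral_mono ((hiw.const_mul _).add (hikw.const_mul _))
      ((hk.exp.mul hw).integrable ν) fun x => ?_
    simp only
    have h := Real.add_one_le_exp (k x - t)
    have : Real.exp (k x) = Real.exp t * Real.exp (k x - t) := by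
      rw [← Real.exp_add]; congr 1; ring
    rw [this]
    nlinarith [mul_le_mul_of_nonneg_right h (mul_nonneg (Real.exp_pos t).le (hw0 x))]
  rw [integral_add (hiw.const_mul _) (hikw.const_mul _), integral_const_mul, integral_const_mul,
    htZ, ← hZ] at h1
  linarith

/-- The mean of `h` with respect to the measure with density proportional to `w`. -/
noncomputable def tiltedMean {Ω : Type*} [MeasurableSpace Ω] (ν : Measure Ω) (w h : Ω → ℝ) : ℝ :=
  (∫ x, h x * w x ∂ν) / ∫ x, w x ∂ν

lemma tiltedMean_sum {Ω J : Type*} [MeasurableSpace Ω] (ν : Measure Ω) [IsFiniteMeasure ν]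
    {w : Ω → ℝ} (hw : BddMeas w) {A : Finset J} (c : J → ℝ) {h : J → Ω → ℝ}
    (hh : ∀ j, BddMeas (h j)) :
    tiltedMean ν w (fun x => ∑ j ∈ A, c j * h j x) = ∑ j ∈ A, c j * tiltedMean ν w (h j) := by
  unfold tiltedMean
  simp_rw [Finset.sum_mul]
  rw [integral_finsetSum _ fun j _ => (((hh j).const_mul _).mul hw).integrable ν,
    Finset.sum_div]
  refine Finset.sum_congr rfl fun j _ => ?_
  simp_rw [mul_assoc]
  rw [integral_const_mul, mul_div_assoc]

/-! ### Riesz products and their entropy. -/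

section Riesz

variable {Ω J : Type*} [MeasurableSpace Ω]

/-- The Riesz product `∏ (1 + β ω_j g_j)`. -/
noncomputable def rieszWeight (β : ℝ) (g : J → Ω → ℝ) (A : Finset J) (ω : J → Bool) (x : Ω) : ℝ :=
  ∏ j ∈ A, (1 + β * boolSign (ω j) * g j x)

variable {β : ℝ} {g : J → Ω → ℝ} {A : Finset J} {ω : J → Bool}

lemma BddMeas.rieszWeight (hg : ∀ j, BddMeas (g j)) : BddMeas (rieszWeight β g A ω) :=
  BddMeas.prod fun j _ => (BddMeas.const 1).add ((hg j).const_mul _)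

omit [MeasurableSpace Ω] in
lemma abs_sign_mul_le (hβ : 0 ≤ β) (hg1 : ∀ j x, |g j x| ≤ 1) (ω : J → Bool) (j : J) (x : Ω) :
    |β * boolSign (ω j) * g j x| ≤ β := by
  rw [abs_mul, abs_mul, abs_boolSign, mul_one, abs_of_nonneg hβ]
  exact mul_le_of_le_one_right hβ (hg1 j x)

omit [MeasurableSpace Ω] in
lemma pow_le_rieszWeight (hβ : 0 ≤ β) (hβ1 : β ≤ 1) (hg1 : ∀ j x, |g j x| ≤ 1) (x : Ω) :
    (1 - β) ^ A.card ≤ rieszWeight β g A ω x := by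
  unfold rieszWeight
  rw [← Finset.prod_const]
  refine Finset.prod_le_prod (fun _ _ => by linarith) fun j _ => ?_
  linarith [(abs_le.1 (abs_sign_mul_le hβ hg1 ω j x)).1]

omit [MeasurableSpace Ω] in
lemma rieszWeight_le_pow (hβ : 0 ≤ β) (hβ1 : β ≤ 1) (hg1 : ∀ j x, |g j x| ≤ 1) (x : Ω) :
    rieszWeight β g A ω x ≤ (1 + β) ^ A.card := by
  unfold rieszWeight
  rw [← Finset.prod_const]
  refine Finset.prod_le_prod (fun j _ => ?_) fun j _ => ?_
  · linarith [(abs_le.1 (abs_sign_mul_le hβ hg1 ω j x)).1]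
  · linarith [(abs_le.1 (abs_sign_mul_le hβ hg1 ω j x)).2]

omit [MeasurableSpace Ω] in
lemma rieszWeight_pos (hβ : 0 ≤ β) (hβ1 : β < 1) (hg1 : ∀ j x, |g j x| ≤ 1) (x : Ω) :
    0 < rieszWeight β g A ω x :=
  (pow_pos (by linarith) _).trans_le (pow_le_rieszWeight hβ hβ1.le hg1 x)

omit [MeasurableSpace Ω] in
lemma rieszWeight_le_exp (hβ : 0 ≤ β) (hβ1 : β ≤ 1) (hg1 : ∀ j x, |g j x| ≤ 1) (x : Ω) :
    rieszWeight β g A ω x ≤ Real.exp (β * ∑ j ∈ A, boolSign (ω j) * g j x) := by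
  unfold rieszWeight
  rw [Finset.mul_sum, Real.exp_sum]
  refine Finset.prod_le_prod (fun j _ => ?_) fun j _ => ?_
  · linarith [(abs_le.1 (abs_sign_mul_le hβ hg1 ω j x)).1]
  · rw [← mul_assoc, add_comm]
    exact Real.add_one_le_exp _

/-- Together with 1 + y ≤ exp y, this traps the Riesz product between exp(βF - β² ∑ g_j²) and
exp(βF), where F is the signed sum. -/
lemma exp_sub_sq_le {y : ℝ} (hy : |y| ≤ 1 / 2) : Real.exp (y - y ^ 2) ≤ 1 + y := by
  obtain ⟨h1, h2⟩ := abs_le.1 hy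
  have hinv : ∀ t : ℝ, 1 ≤ (1 + y) * Real.exp t → Real.exp (-t) ≤ 1 + y := by
    intro t h
    calc Real.exp (-t) ≤ (1 + y) * Real.exp t * Real.exp (-t) :=
          le_mul_of_one_le_left (Real.exp_pos _).le h
      _ = 1 + y := by rw [mul_assoc, ← Real.exp_add]; simp
  have hneg : y - y ^ 2 = -(-y + y ^ 2) := by ring
  rw [hneg]
  refine hinv _ ?_
  rcases le_total 0 y with h | h
  · have h3 := Real.add_one_le_exp (-y + y ^ 2)
    have h4 := mul_le_mul_of_nonneg_left h3 (by linarith : (0 : ℝ) ≤ 1 + y)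
    nlinarith [mul_nonneg (sq_nonneg y) h]
  · have h3 := Real.quadratic_le_exp_of_nonneg (x := -y + y ^ 2) (by nlinarith)
    have h4 := mul_le_mul_of_nonneg_left h3 (by linarith : (0 : ℝ) ≤ 1 + y)
    have h5 : 0 ≤ (1 + y) * (1 - y) ^ 2 / 2 + y := by nlinarith [sq_nonneg y]
    nlinarith [mul_nonneg (sq_nonneg y) h5]

omit [MeasurableSpace Ω] in
lemma exp_le_rieszWeight (hβ : 0 ≤ β) (hβ1 : β ≤ 1 / 2) (hg1 : ∀ j x, |g j x| ≤ 1) (x : Ω) :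
    Real.exp (β * (∑ j ∈ A, boolSign (ω j) * g j x) - β ^ 2 * ∑ j ∈ A, g j x ^ 2) ≤
      rieszWeight β g A ω x := by
  unfold rieszWeight
  rw [Finset.mul_sum, Finset.mul_sum, ← Finset.sum_sub_distrib, Real.exp_sum]
  refine Finset.prod_le_prod (fun j _ => (Real.exp_pos _).le) fun j _ => ?_
  have h := exp_sub_sq_le ((abs_sign_mul_le hβ hg1 ω j x).trans hβ1)
  refine le_trans (le_of_eq ?_) h
  congr 1
  have := boolSign_mul_self (ω j)
  linear_combination (β ^ 2 * g j x ^ 2) * this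

omit [MeasurableSpace Ω] in
lemma rieszWeight_eq_mul_erase [DecidableEq J] {j : J} (hj : j ∈ A) (x : Ω) :
    rieszWeight β g A ω x =
      (1 + β * boolSign (ω j) * g j x) * rieszWeight β g (A.erase j) ω x :=
  (Finset.mul_prod_erase A (fun j => 1 + β * boolSign (ω j) * g j x) hj).symm

omit [MeasurableSpace Ω] in
lemma rieszWeight_erase_flip [DecidableEq J] (j : J) (x : Ω) :
    rieszWeight β g (A.erase j) (flipAt j ω) x = rieszWeight β g (A.erase j) ω x :=
  Finset.prod_congr rfl fun i hi => by rw [flipAt_of_ne (Finset.ne_of_mem_erase hi)]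

lemma integral_rieszWeight_pos (ν : Measure Ω) [IsFiniteMeasure ν] (hν : 0 < ν.real Set.univ)
    (hg : ∀ j, BddMeas (g j)) (hβ : 0 ≤ β) (hβ1 : β < 1) (hg1 : ∀ j x, |g j x| ≤ 1) :
    0 < ∫ x, rieszWeight β g A ω x ∂ν := by
  have h : ∫ _, (1 - β) ^ A.card ∂ν ≤ ∫ x, rieszWeight β g A ω x ∂ν :=
    integral_mono (integrable_const _) ((BddMeas.rieszWeight hg).integrable ν)
      fun x => pow_le_rieszWeight hβ hβ1.le hg1 x
  rw [integral_const, smul_eq_mul] at h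
  exact (mul_pos hν (pow_pos (by linarith) _)).trans_le h

/-- The other factors do not see the flip of ω_j, so `tilt_flip` applies with V the product over
`A.erase j`. -/
lemma rieszWeight_flip [DecidableEq J] (ν : Measure Ω) [IsFiniteMeasure ν]
    (hν : 0 < ν.real Set.univ) (hg : ∀ j, BddMeas (g j)) (hg1 : ∀ j x, |g j x| ≤ 1)
    (hβ : 0 < β) (hβ1 : β ≤ 1 / 10) {j : J} (hj : j ∈ A) :
    (boolSign (ω j) * tiltedMean ν (rieszWeight β g A ω) (g j) +
      boolSign (flipAt j ω j) * tiltedMean ν (rieszWeight β g A (flipAt j ω)) (g j)) / 2 ≤ 2 * β ∧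
    β * (tiltedMean ν (rieszWeight β g A ω) (fun x => g j x ^ 2) / 3
      - 2 * tiltedMean ν (rieszWeight β g A ω) (g j) ^ 2 - 8 * β ^ 2) ≤
    (boolSign (ω j) * tiltedMean ν (rieszWeight β g A ω) (g j) +
      boolSign (flipAt j ω j) * tiltedMean ν (rieszWeight β g A (flipAt j ω)) (g j)) / 2 := by
  have h := tilt_flip ν (V := rieszWeight β g (A.erase j) ω) (u := g j)
    (BddMeas.rieszWeight hg) (hg j)
    (fun x => (rieszWeight_pos hβ.le (by linarith) hg1 x).le) (hg1 j)
    (integral_rieszWeight_pos ν hν hg hβ.le (by linarith) hg1) (boolSign_eq_or (ω j)) hβ hβ1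
  have e1 : ∀ x, rieszWeight β g A ω x =
      (1 + β * boolSign (ω j) * g j x) * rieszWeight β g (A.erase j) ω x :=
    rieszWeight_eq_mul_erase hj
  have e2 : ∀ x, rieszWeight β g A (flipAt j ω) x =
      (1 + β * -boolSign (ω j) * g j x) * rieszWeight β g (A.erase j) ω x := by
    intro x
    rw [rieszWeight_eq_mul_erase hj, rieszWeight_erase_flip, flipAt_self, boolSign_not]
  unfold tiltedMean
  simp_rw [e1, e2, flipAt_self, boolSign_not]
  exact h

/-- An entropy estimate: for a subgaussian μ, a density with means b costs entropy about ∑ b_j² /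
(4D), whereas the normalized Riesz product on B has little. The slopes b_j / (2D) are optimal
against the bound D ∑ (slope)², and the extra exponent -βF absorbs the Riesz product because W ≤
exp(βF). The last term, linear in the signs, averages to zero over ω. -/
lemma sum_sq_tiltedMean_le (μ : Measure Ω) [IsProbabilityMeasure μ] {B : Set Ω}
    (hB0 : 0 < μ.real B) (hg : ∀ j, BddMeas (g j)) (hg1 : ∀ j x, |g j x| ≤ 1)
    (hβ : 0 < β) (hβ1 : β ≤ 1 / 10) {n D : ℝ} (hD : 0 < D) (hgn : ∀ x, ∑ j ∈ A, g j x ^ 2 = n)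
    (hmgf : ∀ b : J → ℝ, ∫ x, Real.exp (∑ j ∈ A, b j * g j x) ∂μ
      ≤ 2 * Real.exp (D * ∑ j ∈ A, b j ^ 2)) :
    (∑ j ∈ A, tiltedMean (μ.restrict B) (rieszWeight β g A ω) (g j) ^ 2) / (4 * D) ≤
      1 - Real.log (μ.real B) + β ^ 2 * n
        + β * ∑ j ∈ A, boolSign (ω j) * tiltedMean (μ.restrict B) (rieszWeight β g A ω) (g j)
        - β * ∑ j ∈ A, boolSign (ω j) * tiltedMean (μ.restrict B) (fun _ => 1) (g j) := by
  set ν := μ.restrict B with hν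
  have hνB : ν.real Set.univ = μ.real B := by simp [hν, measureReal_def]
  set W := rieszWeight β g A ω with hW
  have hWb : BddMeas W := BddMeas.rieszWeight hg
  have hW0 : ∀ x, 0 < W x := fun x => rieszWeight_pos hβ.le (by linarith) hg1 x
  set Z := ∫ x, W x ∂ν with hZ
  have hZ0 : 0 < Z := integral_rieszWeight_pos ν (by rwa [hνB]) hg hβ.le (by linarith) hg1
  set b : J → ℝ := fun j => tiltedMean ν W (g j) with hb
  set F : Ω → ℝ := fun x => ∑ j ∈ A, boolSign (ω j) * g j x with hF
  have hFb : BddMeas F := BddMeas.sum fun j _ => (hg j).const_mul _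
  -- the lower bound for the partition function
  have hlow : Real.log (μ.real B) + β * (∑ j ∈ A, boolSign (ω j) * tiltedMean ν (fun _ => 1) (g j))
      - β ^ 2 * n ≤ Real.log Z := by
    have h1 := mul_exp_div_le_integral ν (w := fun _ => 1) (k := fun x => β * F x - β ^ 2 * n)
      (BddMeas.const 1) ((hFb.const_mul _).sub (BddMeas.const _)) (fun _ => zero_le_one)
      (by simpa [hνB] using hB0)
    have h2 : ∫ x, Real.exp (β * F x - β ^ 2 * n) * 1 ∂ν ≤ Z := by
      refine integral_mono
        ((((hFb.const_mul _).sub (BddMeas.const _)).exp.mul (BddMeas.const 1)).integrable ν)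
        (hWb.integrable ν) fun x => ?_
      have := exp_le_rieszWeight (A := A) (ω := ω) hβ.le (by linarith) hg1 x
      rw [hgn] at this
      simpa using this
    have h3 : (∫ x, (β * F x - β ^ 2 * n) * 1 ∂ν) / ∫ _, (1 : ℝ) ∂ν =
        β * (∑ j ∈ A, boolSign (ω j) * tiltedMean ν (fun _ => 1) (g j)) - β ^ 2 * n := by
      rw [← tiltedMean_sum ν (BddMeas.const 1) _ hg]
      unfold tiltedMean
      simp_rw [mul_one]
      rw [integral_sub ((hFb.const_mul _).integrable ν) (integrable_const _),
        integral_const_mul, integral_const, integral_const, hνB]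
      simp only [smul_eq_mul, mul_one]
      field_simp
      rfl
    rw [h3] at h1
    have h4 := Real.log_le_log (by
      refine mul_pos ?_ (Real.exp_pos _)
      simpa [hνB] using hB0) (h1.trans h2)
    rw [Real.log_mul (by simpa [hνB] using hB0.ne') (Real.exp_pos _).ne', Real.log_exp] at h4
    have h5 : ∫ _, (1 : ℝ) ∂ν = μ.real B := by simp [hνB]
    rw [h5] at h4
    linarith
  -- the variational inequality
  have hup := mul_exp_div_le_integral ν (w := W)
    (k := fun x => (∑ j ∈ A, (1 / (2 * D) * b j) * g j x) - β * F x) hWb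
    ((BddMeas.sum fun j _ => (hg j).const_mul _).sub (hFb.const_mul _)) (fun x => (hW0 x).le) hZ0
  have hup1 : (∫ x, ((∑ j ∈ A, (1 / (2 * D) * b j) * g j x) - β * F x) * W x ∂ν) / Z
      = (∑ j ∈ A, b j ^ 2) / (2 * D) - β * ∑ j ∈ A, boolSign (ω j) * b j := by
    have e : ∀ x, (∑ j ∈ A, (1 / (2 * D) * b j) * g j x) - β * F x =
        ∑ j ∈ A, (1 / (2 * D) * b j - β * boolSign (ω j)) * g j x := by
      intro x
      simp only [hF, Finset.mul_sum, ← Finset.sum_sub_distrib]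
      exact Finset.sum_congr rfl fun j _ => by ring
    simp_rw [e]
    have := tiltedMean_sum ν hWb (A := A) (fun j => 1 / (2 * D) * b j - β * boolSign (ω j)) hg
    unfold tiltedMean at this
    rw [← hZ] at this
    rw [this, Finset.mul_sum, Finset.sum_div, ← Finset.sum_sub_distrib]
    refine Finset.sum_congr rfl fun j _ => ?_
    change _ * b j = _
    ring
  rw [← hZ, hup1] at hup
  have hup2 : ∫ x, Real.exp ((∑ j ∈ A, (1 / (2 * D) * b j) * g j x) - β * F x) * W x ∂ν
      ≤ 2 * Real.exp ((∑ j ∈ A, b j ^ 2) / (4 * D)) := by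
    have hbm : BddMeas (fun x => ∑ j ∈ A, (1 / (2 * D) * b j) * g j x) :=
      BddMeas.sum fun j _ => (hg j).const_mul _
    calc _ ≤ ∫ x, Real.exp (∑ j ∈ A, (1 / (2 * D) * b j) * g j x) ∂ν := by
          refine integral_mono (((hbm.sub (hFb.const_mul _)).exp.mul hWb).integrable ν)
            (hbm.exp.integrable ν) fun x => ?_
          have h := rieszWeight_le_exp (A := A) (ω := ω) hβ.le (by linarith) hg1 x
          simp only
          calc _ ≤ Real.exp ((∑ j ∈ A, (1 / (2 * D) * b j) * g j x) - β * F x) *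
                Real.exp (β * F x) := mul_le_mul_of_nonneg_left h (Real.exp_pos _).le
            _ = _ := by rw [← Real.exp_add]; congr 1; ring
      _ ≤ ∫ x, Real.exp (∑ j ∈ A, (1 / (2 * D) * b j) * g j x) ∂μ :=
          setIntegral_le_integral (hbm.exp.integrable μ)
            (Filter.Eventually.of_forall fun x => (Real.exp_pos _).le)
      _ ≤ _ := hmgf _
      _ = _ := by
          congr 2
          simp_rw [mul_pow, ← Finset.mul_sum]
          field_simp
          ring
  have hlog := Real.log_le_log (mul_pos hZ0 (Real.exp_pos _)) (hup.trans hup2)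
  rw [Real.log_mul hZ0.ne' (Real.exp_pos _).ne', Real.log_mul (by norm_num) (Real.exp_pos _).ne',
    Real.log_exp, Real.log_exp] at hlog
  have hl2 : Real.log 2 ≤ 1 := by linarith [Real.log_two_lt_d9]
  have hhalf : (∑ j ∈ A, b j ^ 2) / (2 * D) = 2 * ((∑ j ∈ A, b j ^ 2) / (4 * D)) := by
    field_simp; ring
  change (∑ j ∈ A, b j ^ 2) / (4 * D) ≤ 1 - Real.log (μ.real B) + β ^ 2 * n
    + β * ∑ j ∈ A, boolSign (ω j) * b j - _
  linarith

end Riesz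

/-! ### One block. -/

section Riesz

variable {Ω J : Type*} [MeasurableSpace Ω] [Fintype J] [DecidableEq J] {g : J → Ω → ℝ}
  {A : Finset J}

/-- Average each term over the flip of its own sign and sum `rieszWeight_flip` over the 2n indices.
Since ∑ g_j² = n pointwise, the tilted second moments add up to n whatever the tilt. -/
lemma expect_sum_tiltedMean (ν : Measure Ω) [IsFiniteMeasure ν]
    (hν : 0 < ν.real Set.univ) (hg : ∀ j, BddMeas (g j)) (hg1 : ∀ j x, |g j x| ≤ 1)
    {β n : ℝ} (hβ : 0 < β) (hβ1 : β ≤ 1 / 10) (hA : (A.card : ℝ) = 2 * n)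
    (hgn : ∀ x, ∑ j ∈ A, g j x ^ 2 = n) :
    (𝔼 ω, ∑ j ∈ A, boolSign (ω j) * tiltedMean ν (rieszWeight β g A ω) (g j)) ≤ 4 * β * n ∧
    β * (n / 3 - 2 * (𝔼 ω, ∑ j ∈ A, tiltedMean ν (rieszWeight β g A ω) (g j) ^ 2)
      - 16 * β ^ 2 * n) ≤
    𝔼 ω, ∑ j ∈ A, boolSign (ω j) * tiltedMean ν (rieszWeight β g A ω) (g j) := by
  have hflip : ∀ j, (𝔼 ω, boolSign (ω j) * tiltedMean ν (rieszWeight β g A ω) (g j)) =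
      𝔼 ω, (boolSign (ω j) * tiltedMean ν (rieszWeight β g A ω) (g j) +
      boolSign (flipAt j ω j) * tiltedMean ν (rieszWeight β g A (flipAt j ω)) (g j)) / 2 :=
    fun j => expect_eq_half j _
  rw [Finset.expect_sum_comm, Finset.expect_sum_comm]
  constructor
  · calc _ ≤ ∑ j ∈ A, 2 * β := by
          refine Finset.sum_le_sum fun j hj => ?_
          rw [hflip]
          exact Finset.expect_le Finset.univ_nonempty
            fun ω _ => (rieszWeight_flip ν hν hg hg1 hβ hβ1 hj).1
      _ = _ := by rw [Finset.sum_const, nsmul_eq_mul, hA]; ring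
  · have hq : ∀ ω, ∑ j ∈ A, tiltedMean ν (rieszWeight β g A ω) (fun x => g j x ^ 2) = n := by
      intro ω
      have h := tiltedMean_sum ν (BddMeas.rieszWeight (β := β) (A := A) (ω := ω) hg) (A := A)
        (fun _ => 1) (fun j => (hg j).pow 2)
      simp only [one_mul] at h
      rw [← h]
      simp_rw [hgn]
      unfold tiltedMean
      rw [integral_const_mul]
      exact mul_div_cancel_right₀ _
        (integral_rieszWeight_pos ν hν hg hβ.le (by linarith) hg1).ne'
    have hlow : ∀ j ∈ A, β * ((𝔼 ω, tiltedMean ν (rieszWeight β g A ω) (fun x => g j x ^ 2)) / 3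
        - 2 * (𝔼 ω, tiltedMean ν (rieszWeight β g A ω) (g j) ^ 2) - 8 * β ^ 2) ≤
        𝔼 ω, boolSign (ω j) * tiltedMean ν (rieszWeight β g A ω) (g j) := by
      intro j hj
      rw [hflip]
      refine le_trans (le_of_eq ?_) (Finset.expect_le_expect fun ω _ =>
        (rieszWeight_flip ν hν hg hg1 hβ hβ1 (ω := ω) hj).2)
      rw [← Finset.mul_expect, Finset.expect_sub_distrib, Finset.expect_sub_distrib,
        ← Finset.expect_div, ← Finset.mul_expect, Fintype.expect_const]
    refine le_trans (le_of_eq ?_) (Finset.sum_le_sum hlow)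
    rw [← Finset.mul_sum, Finset.sum_sub_distrib, Finset.sum_sub_distrib, ← Finset.sum_div,
      ← Finset.mul_sum, ← Finset.expect_sum_comm Finset.univ A
        (fun ω j => tiltedMean ν (rieszWeight β g A ω) (fun x => g j x ^ 2))]
    simp_rw [hq]
    rw [Fintype.expect_const, Finset.sum_const, nsmul_eq_mul, hA]
    ring

omit [Fintype J] [DecidableEq J] in
/-- A measurable part of `B`, of measure not much smaller than `B`, on which the linear form
exceeds its tilted mean up to a small error. -/
lemma measure_superlevel_ge (μ : Measure Ω) [IsProbabilityMeasure μ] {B : Set Ω}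
    (hBm : MeasurableSet B) (hB0 : 0 < μ.real B) (hg : ∀ j, BddMeas (g j))
    (hg1 : ∀ j x, |g j x| ≤ 1) {β n : ℝ} (hβ : 0 < β) (hβ1 : β ≤ 1 / 10) (hn : 0 < n)
    (hA : (A.card : ℝ) = 2 * n) (ω : J → Bool) :
    β / 60 * Real.exp (-(2 * n)) * μ.real B ≤ μ.real {x ∈ B |
      (∑ j ∈ A, boolSign (ω j) * tiltedMean (μ.restrict B) (rieszWeight β g A ω) (g j))
        - β * n / 12 ≤ ∑ j ∈ A, boolSign (ω j) * g j x} := by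
  set ν := μ.restrict B with hν
  have hνB : ν.real Set.univ = μ.real B := by simp [hν, measureReal_def]
  set W := rieszWeight β g A ω with hW
  have hWb : BddMeas W := BddMeas.rieszWeight hg
  have hW0 : ∀ x, 0 < W x := fun x => rieszWeight_pos hβ.le (by linarith) hg1 x
  set Z := ∫ x, W x ∂ν with hZ
  have hZ0 : 0 < Z := integral_rieszWeight_pos ν (by rwa [hνB]) hg hβ.le (by linarith) hg1
  set m := ∑ j ∈ A, boolSign (ω j) * tiltedMean ν W (g j) with hm
  set F : Ω → ℝ := fun x => ∑ j ∈ A, boolSign (ω j) * g j x with hF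
  have hFb : BddMeas F := BddMeas.sum fun j _ => (hg j).const_mul _
  set t := m - β * n / 12 with ht
  set B' := {x ∈ B | t ≤ F x} with hB'
  have hB'm : MeasurableSet B' := hBm.inter (measurableSet_le measurable_const hFb.1)
  have hFabs : ∀ x, |F x| ≤ 2 * n := by
    intro x
    calc |F x| ≤ ∑ j ∈ A, |boolSign (ω j) * g j x| := Finset.abs_sum_le_sum_abs _ _
      _ ≤ ∑ j ∈ A, 1 := Finset.sum_le_sum fun j _ => by
          rw [abs_mul, abs_boolSign, one_mul]; exact hg1 j x
      _ = 2 * n := by simp [hA]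
  have hmZ : ∫ x, F x * W x ∂ν = m * Z := by
    have h := tiltedMean_sum ν hWb (A := A) (fun j => boolSign (ω j)) hg
    rw [← hm] at h
    rw [← h]
    unfold tiltedMean
    rw [← hZ, div_mul_cancel₀ _ hZ0.ne']
  have hmlow : -(2 * n) ≤ m := by
    have h1 : ∫ x, -(2 * n) * W x ∂ν ≤ ∫ x, F x * W x ∂ν :=
      integral_mono ((hWb.const_mul _).integrable ν) ((hFb.mul hWb).integrable ν) fun x =>
        mul_le_mul_of_nonneg_right (abs_le.1 (hFabs x)).1 (hW0 x).le
    rw [integral_const_mul, hmZ] at h1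
    exact le_of_mul_le_mul_right h1 hZ0
  have hWup : ∀ x, W x ≤ Real.exp n := by
    intro x
    refine (rieszWeight_le_pow hβ.le (by linarith) hg1 x).trans ?_
    calc (1 + β) ^ A.card ≤ Real.exp β ^ A.card := by
          refine pow_le_pow_left₀ (by linarith) ?_ _
          linarith [Real.add_one_le_exp β]
      _ = Real.exp (β * (2 * n)) := by rw [← Real.exp_nat_mul, hA]; congr 1; ring
      _ ≤ _ := Real.exp_le_exp.2 (by nlinarith)
  have hZlow : Real.exp (-n) * μ.real B ≤ Z := by
    have h1 : ∫ _, Real.exp (-n) ∂ν ≤ Z := by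
      refine integral_mono (integrable_const _) (hWb.integrable ν) fun x => ?_
      refine le_trans ?_ (pow_le_rieszWeight hβ.le (by linarith) hg1 x)
      have h := exp_sub_sq_le (y := -β) (by rw [abs_neg, abs_of_pos hβ]; linarith)
      calc Real.exp (-n) ≤ Real.exp ((-β - (-β) ^ 2) * (2 * n)) :=
            Real.exp_le_exp.2 (by
              have hb : 0 ≤ 1 / 2 - β - β ^ 2 := by nlinarith
              nlinarith [mul_nonneg hn.le hb])
        _ = Real.exp (-β - (-β) ^ 2) ^ A.card := by
            rw [← Real.exp_nat_mul, hA]; congr 1; ring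
        _ ≤ (1 - β) ^ A.card := pow_le_pow_left₀ (Real.exp_pos _).le (by linarith) _
    rw [integral_const, hνB, smul_eq_mul] at h1
    linarith
  -- Since |F| ≤ 2n and t ≥ -2n - βn/12, the excess F - t is at most 5n. With W ≤ exp n, a point of
  -- B' contributes at most 5n exp n to the integral of (F - t) W.
  have hind : BddMeas (B'.indicator fun _ => 5 * n * Real.exp n) := by
    refine ⟨measurable_const.indicator hB'm, 5 * n * Real.exp n, fun x => ?_⟩
    have : 0 ≤ 5 * n * Real.exp n := by positivity
    by_cases hx : x ∈ B' <;> simp [hx, abs_of_nonneg, this]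
  have hmain : ∫ x, F x * W x ∂ν ≤
      ∫ x, (t * W x + B'.indicator (fun _ => 5 * n * Real.exp n) x) ∂ν := by
    refine setIntegral_mono_on ((hFb.mul hWb).integrable ν)
      (((hWb.const_mul _).add hind).integrable ν) hBm fun x hx => ?_
    by_cases hxt : t ≤ F x
    · have hxB : x ∈ B' := ⟨hx, hxt⟩
      rw [Set.indicator_of_mem hxB]
      have h1 : F x - t ≤ 5 * n := by
        have := (abs_le.1 (hFabs x)).2
        rw [ht]; nlinarith
      have h2 : (F x - t) * W x ≤ 5 * n * Real.exp n :=
        mul_le_mul h1 (hWup x) (hW0 x).le (by positivity)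
      linarith
    · have hxB : x ∉ B' := fun h => hxt h.2
      rw [Set.indicator_of_notMem hxB, add_zero]
      exact mul_le_mul_of_nonneg_right (not_le.1 hxt).le (hW0 x).le
  rw [integral_add ((hWb.const_mul _).integrable ν) (hind.integrable ν), integral_const_mul,
    integral_indicator_const _ hB'm, hmZ, ← hZ, smul_eq_mul] at hmain
  have hνB' : ν.real B' ≤ μ.real B' := by
    rw [hν, measureReal_restrict_apply hB'm]
    exact measureReal_mono Set.inter_subset_left
  have h1 : β * n / 12 * Z ≤ 5 * n * Real.exp n * μ.real B' := by
    have : ν.real B' * (5 * n * Real.exp n) ≤ μ.real B' * (5 * n * Real.exp n) :=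
      mul_le_mul_of_nonneg_right hνB' (by positivity)
    have e : m * Z - t * Z = β * n / 12 * Z := by rw [ht]; ring
    linarith
  have h2 : β / 60 * (Real.exp (-n) * μ.real B) ≤ Real.exp n * μ.real B' := by
    have h3 := (mul_le_mul_of_nonneg_left hZlow (by positivity : 0 ≤ β * n / 12)).trans h1
    have h4 : 5 * n * (β / 60 * (Real.exp (-n) * μ.real B)) ≤ 5 * n * (Real.exp n * μ.real B') := by
      linarith
    exact le_of_mul_le_mul_left h4 (by positivity)
  have h5 := mul_le_mul_of_nonneg_left h2 (Real.exp_pos (-n)).le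
  have e1 : Real.exp (-n) * (β / 60 * (Real.exp (-n) * μ.real B)) =
      β / 60 * Real.exp (-(2 * n)) * μ.real B := by
    have : Real.exp (-(2 * n)) = Real.exp (-n) * Real.exp (-n) := by
      rw [← Real.exp_add]; congr 1; ring
    rw [this]; ring
  have e2 : Real.exp (-n) * (Real.exp n * μ.real B') = μ.real B' := by
    rw [← mul_assoc, ← Real.exp_add]; simp
  rwa [e1, e2] at h5

/-- One block: on a set `B` that is not too small, for most signs the signed sum over the block is
large on a part of `B` that is not too small either. -/
lemma exists_large_on_subset (μ : Measure Ω) [IsProbabilityMeasure μ] {B : Set Ω}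
    (hBm : MeasurableSet B) (hg : ∀ j, BddMeas (g j)) (hg1 : ∀ j x, |g j x| ≤ 1)
    {n D : ℝ} (hD : 1 ≤ D) (hn : 400 * D ≤ n) (hA : (A.card : ℝ) = 2 * n)
    (hgn : ∀ x, ∑ j ∈ A, g j x ^ 2 = n)
    (hmgf : ∀ b : J → ℝ, ∫ x, Real.exp (∑ j ∈ A, b j * g j x) ∂μ
      ≤ 2 * Real.exp (D * ∑ j ∈ A, b j ^ 2))
    (hB : Real.exp (-(n / (400 * D))) ≤ μ.real B) :
    ∃ (B' : (J → Bool) → Set Ω) (t : (J → Bool) → ℝ),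
      (∀ ω, MeasurableSet (B' ω) ∧ B' ω ⊆ B ∧ Real.exp (-(5 * n)) ≤ μ.real (B' ω) ∧
        ∀ x ∈ B' ω, t ω ≤ ∑ j ∈ A, boolSign (ω j) * g j x) ∧
      n / (600 * D) ≤ 𝔼 ω, t ω := by
  have hD0 : 0 < D := by linarith
  have hn0 : 0 < n := by linarith
  -- Small enough that the entropy estimate keeps the averaged sum of squared tilted means below
  -- 3n/100, so that the averaged tilted mean is at least βn/6. After the loss βn/12 in
  -- `measure_superlevel_ge` there remains βn/12 = n / (600 D).
  set β := 1 / (50 * D) with hβ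
  have hβ0 : 0 < β := by positivity
  have hβD : β * D = 1 / 50 := by rw [hβ]; field_simp
  have hβ1 : β ≤ 1 / 50 := by nlinarith
  have hB0 : 0 < μ.real B := (Real.exp_pos _).trans_le hB
  have hlogB : -Real.log (μ.real B) ≤ n / (400 * D) := by
    have := Real.log_le_log (Real.exp_pos _) hB
    rw [Real.log_exp] at this
    linarith
  have hνB : (μ.restrict B).real Set.univ = μ.real B := by simp [measureReal_def]
  obtain ⟨hE1, hE2⟩ := expect_sum_tiltedMean (μ.restrict B) (by rwa [hνB]) hg hg1 hβ0
    (by linarith) hA hgn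
  set E := 𝔼 ω, ∑ j ∈ A, boolSign (ω j) * tiltedMean (μ.restrict B) (rieszWeight β g A ω) (g j)
    with hE
  set S := 𝔼 ω, ∑ j ∈ A, tiltedMean (μ.restrict B) (rieszWeight β g A ω) (g j) ^ 2 with hS
  have hSle : S / (4 * D) ≤ 1 + n / (400 * D) + β ^ 2 * n + β * E := by
    have h := Finset.expect_le_expect (s := (Finset.univ : Finset (J → Bool))) fun ω _ =>
      sum_sq_tiltedMean_le (ω := ω) μ hB0 hg hg1 hβ0 (by linarith) hD0 hgn hmgf
    rw [← Finset.expect_div, Finset.expect_sub_distrib, Finset.expect_add_distrib,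
      Fintype.expect_const, ← Finset.mul_expect, ← Finset.mul_expect, ← hE, ← hS,
      Finset.expect_sum_comm Finset.univ A
        (fun (ω : J → Bool) j => boolSign (ω j) * tiltedMean (μ.restrict B) (fun _ => 1) (g j))] at h
    -- The means over B without tilt do not depend on ω.
    have h0 : ∑ j ∈ A, 𝔼 ω : J → Bool,
        boolSign (ω j) * tiltedMean (μ.restrict B) (fun _ => 1) (g j) = 0 :=
      Finset.sum_eq_zero fun j _ => by rw [← Finset.expect_mul, expect_boolSign, zero_mul]
    rw [h0] at h
    linarith
  have hS3 : S ≤ 3 * n / 100 := by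
    rw [div_le_iff₀ (by positivity)] at hSle
    have e1 : n / (400 * D) * (4 * D) = n / 100 := by field_simp; norm_num
    have e2 : β ^ 2 * n * (4 * D) = 4 * n * (β * (β * D)) := by ring
    have e3 : β * E * (4 * D) = 4 * E * (β * D) := by ring
    have e4 : E / 50 ≤ 4 * n / 2500 := by nlinarith
    have e5 : (1 + n / (400 * D) + β ^ 2 * n + β * E) * (4 * D) =
      4 * D + n / (400 * D) * (4 * D) + β ^ 2 * n * (4 * D) + β * E * (4 * D) := by ring
    rw [e5, e1, e2, e3, hβD] at hSle
    nlinarith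
  have hElow : β * n / 6 ≤ E := by
    refine le_trans ?_ hE2
    have : n / 6 ≤ n / 3 - 2 * S - 16 * β ^ 2 * n := by
      have : β ^ 2 ≤ 1 / 2500 := by nlinarith
      nlinarith
    calc β * n / 6 = β * (n / 6) := by ring
      _ ≤ _ := mul_le_mul_of_nonneg_left this hβ0.le
  refine ⟨fun ω => {x ∈ B |
      (∑ j ∈ A, boolSign (ω j) * tiltedMean (μ.restrict B) (rieszWeight β g A ω) (g j))
        - β * n / 12 ≤ ∑ j ∈ A, boolSign (ω j) * g j x},
    fun ω => (∑ j ∈ A, boolSign (ω j) * tiltedMean (μ.restrict B) (rieszWeight β g A ω) (g j))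
        - β * n / 12, fun ω => ⟨?_, fun x hx => hx.1, ?_, fun x hx => hx.2⟩, ?_⟩
  · have hF : BddMeas (fun x => ∑ j ∈ A, boolSign (ω j) * g j x) :=
      BddMeas.sum fun j _ => (hg j).const_mul _
    exact hBm.inter (measurableSet_le measurable_const hF.1)
  · refine le_trans ?_ (measure_superlevel_ge μ hBm hB0 hg hg1 hβ0 (by linarith) hn0 hA ω)
    -- As n ≥ 400 D, exp n exceeds 60 / β = 3000 D, so this prefactor costs no more than another
    -- exp(-n).
    have h1 : Real.exp (-n) ≤ β / 60 := by
      rw [Real.exp_neg, inv_le_comm₀ (Real.exp_pos _) (by positivity)]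
      have h2 := Real.quadratic_le_exp_of_nonneg hn0.le
      have h3 : (β / 60)⁻¹ = 3000 * D := by rw [hβ]; field_simp; norm_num
      rw [h3]; nlinarith
    have h2 : Real.exp (-n) ≤ μ.real B := by
      refine le_trans (Real.exp_le_exp.2 ?_) hB
      rw [neg_le_neg_iff, div_le_iff₀ (by positivity)]
      nlinarith
    calc Real.exp (-(5 * n)) ≤ Real.exp (-n) * Real.exp (-(2 * n)) * Real.exp (-n) := by
          rw [← Real.exp_add, ← Real.exp_add]
          exact Real.exp_le_exp.2 (by linarith)
      _ ≤ _ := by gcongr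
  · rw [Finset.expect_sub_distrib, Fintype.expect_const, ← hE]
    have : n / (600 * D) = β * n / 12 := by rw [hβ]; field_simp; norm_num
    linarith

end Riesz

/-! ### Gluing blocks of geometric size. -/

section Blocks

variable {Ω J : Type*} [MeasurableSpace Ω] [Fintype J] [DecidableEq J] {g : J → Ω → ℝ}

/-- Induction on the number m of blocks still to come, for every B above the measure threshold of
block k. The signs of block k select a part B' of B; the later signs are independent of that choice,
so the induction hypothesis applies inside B' for each fixed choice. -/
lemma expect_sSup_blocks_ge (μ : Measure Ω) [IsProbabilityMeasure μ]
    (hg : ∀ j, BddMeas (g j)) (hg1 : ∀ j x, |g j x| ≤ 1) {D : ℝ} (hD : 1 ≤ D) {K : ℕ}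
    {A : ℕ → Finset J} {n w : ℕ → ℝ} (hdisj : ∀ k l, k ≠ l → Disjoint (A k) (A l))
    (hw : ∀ k, 0 ≤ w k) (hn : ∀ k < K, 400 * D ≤ n k)
    (hnn : ∀ k, 2000 * D * n k ≤ n (k + 1))
    (hA : ∀ k < K, ((A k).card : ℝ) = 2 * n k) (hgn : ∀ k < K, ∀ x, ∑ j ∈ A k, g j x ^ 2 = n k)
    (hmgf : ∀ k < K, ∀ b : J → ℝ, ∫ x, Real.exp (∑ j ∈ A k, b j * g j x) ∂μ
      ≤ 2 * Real.exp (D * ∑ j ∈ A k, b j ^ 2)) (m k : ℕ) (hk : k + m = K) {B : Set Ω}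
    (hBm : MeasurableSet B) (hB : Real.exp (-(n k / (400 * D))) ≤ μ.real B) :
    (∑ i ∈ Finset.Ico k K, w i * n i) / (600 * D) ≤
      𝔼 ω : J → Bool, sSup ((fun x => ∑ i ∈ Finset.Ico k K,
        w i * ∑ j ∈ A i, boolSign (ω j) * g j x) '' B) := by
  have hD0 : 0 < D := by linarith
  induction m generalizing k B with
  | zero =>
    have hne : B.Nonempty := by
      rw [Set.nonempty_iff_ne_empty]
      rintro rfl
      simp at hB
      exact absurd hB (not_le.2 (Real.exp_pos _))
    subst hk
    simp [hne.image_const]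
  | succ m ih =>
    have hkK : k < K := by omega
    obtain ⟨B', t, hB', ht⟩ := exists_large_on_subset μ hBm hg hg1 hD (hn k hkK) (hA k hkK)
      (hgn k hkK) (hmgf k hkK) hB
    have hbdd : ∀ (ω : J → Bool) (B : Set Ω) (k : ℕ), BddAbove ((fun x => ∑ i ∈ Finset.Ico k K,
        w i * ∑ j ∈ A i, boolSign (ω j) * g j x) '' B) := by
      intro ω B k
      have hb : BddMeas (fun x => ∑ i ∈ Finset.Ico k K,
        w i * ∑ j ∈ A i, boolSign (ω j) * g j x) :=
        BddMeas.sum fun i _ => (BddMeas.sum fun j _ => (hg j).const_mul _).const_mul _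
      obtain ⟨-, M, hM⟩ := hb
      refine ⟨M, ?_⟩
      rintro _ ⟨x, -, rfl⟩
      exact (le_abs_self _).trans (hM x)
    have hne : ∀ η, (B' η).Nonempty := by
      intro η
      rw [Set.nonempty_iff_ne_empty]
      intro h
      have := (hB' η).2.2.1
      rw [h] at this
      simp at this
      exact absurd this (not_le.2 (Real.exp_pos _))
    have hstep : ∀ η ω : J → Bool, w k * t η + sSup ((fun x => ∑ i ∈ Finset.Ico (k + 1) K,
        w i * ∑ j ∈ A i, boolSign (ω j) * g j x) '' B' η) ≤
        sSup ((fun x => ∑ i ∈ Finset.Ico k K,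
          w i * ∑ j ∈ A i, boolSign ((A k).piecewise η ω j) * g j x) '' B) := by
      intro η ω
      rw [← le_sub_iff_add_le']
      refine csSup_le ((hne η).image _) ?_
      rintro _ ⟨x, hx, rfl⟩
      rw [le_sub_iff_add_le']
      refine le_trans ?_ (le_csSup (hbdd _ B k) ⟨x, (hB' η).2.1 hx, rfl⟩)
      simp only
      rw [Finset.sum_eq_sum_Ico_succ_bot hkK]
      refine add_le_add ?_ (le_of_eq ?_)
      · refine mul_le_mul_of_nonneg_left (((hB' η).2.2.2 x hx).trans (le_of_eq ?_)) (hw k)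
        exact Finset.sum_congr rfl fun j hj => by rw [Finset.piecewise_eq_of_mem _ _ _ hj]
      · refine Finset.sum_congr rfl fun i hi => ?_
        congr 1
        refine Finset.sum_congr rfl fun j hj => ?_
        have hik : i ≠ k := by have := (Finset.mem_Ico.1 hi).1; omega
        rw [Finset.piecewise_eq_of_notMem _ _ _
          (Finset.disjoint_left.1 (hdisj i k hik) hj)]
    have hIH : ∀ η, (∑ i ∈ Finset.Ico (k + 1) K, w i * n i) / (600 * D) ≤
        𝔼 ω : J → Bool, sSup ((fun x => ∑ i ∈ Finset.Ico (k + 1) K,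
          w i * ∑ j ∈ A i, boolSign (ω j) * g j x) '' B' η) := by
      intro η
      -- The measure bound exp(-5 n_k) meets the next threshold exp(-n_{k+1} / (400 D)) because
      -- n_{k+1} ≥ 2000 D n_k.
      refine ih (k + 1) (by omega) (hB' η).1 (le_trans (Real.exp_le_exp.2 ?_) (hB' η).2.2.1)
      rw [neg_le_neg_iff, le_div_iff₀ (by positivity)]
      linarith [hnn k]
    -- η supplies the signs on A k and ω those of the later blocks. That B' η may depend on all of η
    -- is harmless, since ω is independent of η.
    rw [← expect_piecewise (A k), Finset.sum_eq_sum_Ico_succ_bot hkK]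
    calc _ = w k * (n k / (600 * D)) + (∑ i ∈ Finset.Ico (k + 1) K, w i * n i) / (600 * D) := by
          ring
      _ ≤ w k * (𝔼 η, t η) + 𝔼 η : J → Bool, 𝔼 ω : J → Bool, sSup ((fun x =>
          ∑ i ∈ Finset.Ico (k + 1) K, w i * ∑ j ∈ A i, boolSign (ω j) * g j x) '' B' η) := by
          refine add_le_add (mul_le_mul_of_nonneg_left ht (hw k)) ?_
          exact Finset.le_expect Finset.univ_nonempty fun η _ => hIH η
      _ = 𝔼 η : J → Bool, 𝔼 ω : J → Bool, (w k * t η + sSup ((fun x =>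
          ∑ i ∈ Finset.Ico (k + 1) K, w i * ∑ j ∈ A i, boolSign (ω j) * g j x) '' B' η)) := by
          simp_rw [Finset.expect_add_distrib, Fintype.expect_const, Finset.mul_expect]
      _ ≤ _ := Finset.expect_le_expect fun η _ => Finset.expect_le_expect fun ω _ => hstep η ω

end Blocks

/-- Sort decreasingly and condense at the powers of R. The last value w_k of block k bounds the
terms of block k + 1, which is R times as long; this is the factor R. The initial terms are bounded
by the largest value a i₀. -/
lemma exists_geometric_blocks {ι : Type*} [Fintype ι] [Nonempty ι] (a : ι → ℝ)
    (ha : ∀ i, 0 ≤ a i) {R : ℕ} (hR : 2 ≤ R) :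
    ∃ (K : ℕ) (T : ℕ → Finset ι) (w : ℕ → ℝ) (i₀ : ι),
      (∀ k < K, (T k).card = R ^ k * (R - 1)) ∧ (∀ k l, k ≠ l → Disjoint (T k) (T l)) ∧
      (∀ k, 0 ≤ w k) ∧ (∀ k, ∀ i ∈ T k, w k ≤ a i) ∧
      ∑ i, a i ≤ R * a i₀ + R * ∑ k ∈ Finset.range K, w k * (R ^ k * (R - 1) : ℕ) := by
  classical
  set N := Fintype.card ι with hN
  have hN0 : 0 < N := Fintype.card_pos
  obtain ⟨e, he⟩ : ∃ e : Fin N ≃ ι, Antitone (a ∘ e) := by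
    let e₀ : Fin N ≃ ι := (Fintype.equivFin ι).symm
    refine ⟨(Tuple.sort (fun n => -a (e₀ n))).trans e₀, ?_⟩
    intro m n hmn
    have := Tuple.monotone_sort (fun n => -a (e₀ n)) hmn
    simpa using this
  set b : ℕ → ℝ := fun n => if h : n < N then a (e ⟨n, h⟩) else 0 with hb
  have hb0 : ∀ n, 0 ≤ b n := by
    intro n
    simp only [hb]
    split_ifs
    · exact ha _
    · exact le_rfl
  have hbanti : Antitone b := by
    intro m n hmn
    by_cases h : n < N
    · have hm : m < N := lt_of_le_of_lt hmn h
      simp only [hb, h, hm, dif_pos]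
      exact he (show (⟨m, hm⟩ : Fin N) ≤ ⟨n, h⟩ from hmn)
    · have : b n = 0 := by simp [hb, h]
      rw [this]; exact hb0 m
  have hbe : ∀ i, b (e.symm i) = a i := by
    intro i; simp [hb]
  have hsum : ∑ i, a i = ∑ n ∈ Finset.range N, b n := by
    rw [← Fin.sum_univ_eq_sum_range, ← e.sum_comp]
    refine Finset.sum_congr rfl fun n _ => ?_
    rw [← hbe]; simp
  have hex : ∃ K, N ≤ R ^ (K + 1) :=
    ⟨N, (Nat.lt_pow_self (by omega : 1 < R)).le.trans (Nat.pow_le_pow_right (by omega) (by omega))⟩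
  -- By minimality every block with k < K is full. The incomplete block K is paid for by w_{K-1}, or
  -- by the largest value if K = 0.
  set K := Nat.find hex with hK
  have hKspec : N ≤ R ^ (K + 1) := Nat.find_spec hex
  have hKmin : ∀ k < K, R ^ (k + 1) < N := fun k hk => not_le.1 (Nat.find_min hex hk)
  refine ⟨K, fun k => Finset.univ.filter fun i =>
      R ^ k < (e.symm i : ℕ) ∧ (e.symm i : ℕ) ≤ R ^ (k + 1), fun k => b (R ^ (k + 1)),
      e ⟨0, hN0⟩, ?_, ?_, fun k => hb0 _, ?_, ?_⟩
  · intro k hk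
    have hinj : Function.Injective (fun i => (e.symm i : ℕ)) :=
      Fin.val_injective.comp e.symm.injective
    rw [← Finset.card_image_of_injective _ hinj]
    have : (Finset.univ.filter fun i =>
      R ^ k < (e.symm i : ℕ) ∧ (e.symm i : ℕ) ≤ R ^ (k + 1)).image (fun i => (e.symm i : ℕ)) =
        Finset.Ioc (R ^ k) (R ^ (k + 1)) := by
      ext n
      simp only [Finset.mem_image, Finset.mem_filter, Finset.mem_univ, true_and, Finset.mem_Ioc]
      constructor
      · rintro ⟨i, hi, rfl⟩; exact hi
      · intro hn
        exact ⟨e ⟨n, hn.2.trans_lt (hKmin k hk)⟩, by simpa using hn, by simp⟩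
    rw [this, Nat.card_Ioc, pow_succ, Nat.mul_sub, mul_one]
  · intro k l hkl
    rw [Finset.disjoint_left]
    intro i hi hi'
    simp only [Finset.mem_filter, Finset.mem_univ, true_and] at hi hi'
    rcases lt_or_gt_of_ne hkl with h | h
    · have := Nat.pow_le_pow_right (by omega : 0 < R) (show k + 1 ≤ l from h)
      omega
    · have := Nat.pow_le_pow_right (by omega : 0 < R) (show l + 1 ≤ k from h)
      omega
  · intro k i hi
    simp only [Finset.mem_filter, Finset.mem_univ, true_and] at hi
    rw [← hbe i]
    exact hbanti hi.2
  · have hcond := Finset.le_sum_schlomilch' (f := b) (u := fun k => R ^ k)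
      (fun m n _ h => hbanti h) (fun n => Nat.pos_of_ne_zero (by positivity))
      (fun m n h => Nat.pow_le_pow_right (by omega) h) (K + 1)
    have h0 : ∑ n ∈ Finset.range N, b n ≤ b 0 + ∑ n ∈ Finset.Ico 1 (R ^ (K + 1)), b n := by
      have hpos : 0 < R ^ (K + 1) := Nat.pos_of_ne_zero (by positivity)
      calc _ ≤ ∑ n ∈ Finset.range (R ^ (K + 1)), b n :=
            Finset.sum_le_sum_of_subset_of_nonneg (Finset.range_subset_range.2 hKspec)
              fun n _ _ => hb0 n
        _ = _ := by
            rw [Finset.range_eq_Ico, Finset.sum_eq_sum_Ico_succ_bot hpos]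
    have hb1 : b 1 ≤ b 0 := hbanti (by norm_num)
    have hb00 : b 0 = a (e ⟨0, hN0⟩) := by simp [hb, hN0]
    rw [hsum, ← hb00]
    refine h0.trans ?_
    rw [pow_zero, Finset.sum_range_succ'] at hcond
    have hR1 : ((R - 1 : ℕ) : ℝ) = R - 1 := by
      rw [Nat.cast_sub (by omega)]; simp
    have e1 : ∑ k ∈ Finset.range K, (R ^ (k + 1 + 1) - R ^ (k + 1)) • b (R ^ (k + 1)) =
        R * ∑ k ∈ Finset.range K, b (R ^ (k + 1)) * (R ^ k * (R - 1) : ℕ) := by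
      rw [Finset.mul_sum]
      refine Finset.sum_congr rfl fun k _ => ?_
      have : R ^ (k + 1 + 1) - R ^ (k + 1) = R * (R ^ k * (R - 1)) := by
        rw [Nat.mul_sub, Nat.mul_sub]; ring_nf
      rw [this, nsmul_eq_mul]
      push_cast
      ring
    rw [e1] at hcond
    have e2 : (R ^ (0 + 1) - R ^ 0) • b (R ^ 0) = (R - 1 : ℝ) * b 1 := by
      rw [nsmul_eq_mul, zero_add, pow_one, pow_zero, hR1]
    rw [e2] at hcond
    have hR2 : (2 : ℝ) ≤ R := by exact_mod_cast hR
    nlinarith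

/-! ### From subgaussian to Rademacher–Sidon. -/

section RademacherSidon

variable {Ω : Type*}

lemma convexOn_sSup_range_linear [Nonempty Ω] {J : Type*} [Fintype J] (G : J → Ω → ℝ)
    (hG : ∀ j, ∃ M, ∀ x, |G j x| ≤ M) :
    (∀ v : J → ℝ, BddAbove (Set.range fun x => ∑ j, v j * G j x)) ∧
    ConvexOn ℝ Set.univ (fun v : J → ℝ => sSup (Set.range fun x => ∑ j, v j * G j x)) := by
  choose M hM using hG
  have hbdd : ∀ v : J → ℝ, BddAbove (Set.range fun x => ∑ j, v j * G j x) := by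
    intro v
    refine ⟨∑ j, |v j| * M j, ?_⟩
    rintro _ ⟨x, rfl⟩
    refine Finset.sum_le_sum fun j _ => (le_abs_self _).trans ?_
    rw [abs_mul]
    exact mul_le_mul_of_nonneg_left (hM j x) (abs_nonneg _)
  refine ⟨hbdd, convex_univ, fun v _ v' _ s t hs ht _ => ?_⟩
  refine csSup_le (Set.range_nonempty _) ?_
  rintro _ ⟨x, rfl⟩
  have h1 := mul_le_mul_of_nonneg_left (le_csSup (hbdd v) ⟨x, rfl⟩) hs
  have h2 := mul_le_mul_of_nonneg_left (le_csSup (hbdd v') ⟨x, rfl⟩) ht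
  simp only [smul_eq_mul] at *
  refine le_trans (le_of_eq ?_) (add_le_add h1 h2)
  simp only [Pi.add_apply, Pi.smul_apply, smul_eq_mul, add_mul, Finset.sum_add_distrib,
    Finset.mul_sum, mul_assoc]

/-- The supremum over `Ω` of the modulus of a linear combination of the system `φ`. -/
noncomputable def supNorm {ι : Type*} [Fintype ι] (φ : ι → Ω → ℂ) (a : ι → ℂ) : ℝ :=
  sSup (Set.range fun x => ‖∑ i, a i * φ i x‖)

lemma bddAbove_supNorm {ι : Type*} [Fintype ι] {φ : ι → Ω → ℂ} (hφ : ∀ i x, ‖φ i x‖ = 1)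
    (a : ι → ℂ) : BddAbove (Set.range fun x => ‖∑ i, a i * φ i x‖) := by
  refine ⟨∑ i, ‖a i‖, ?_⟩
  rintro _ ⟨x, rfl⟩
  refine (norm_sum_le _ _).trans (Finset.sum_le_sum fun i _ => ?_)
  rw [norm_mul, hφ, mul_one]

lemma norm_sum_le_supNorm {ι : Type*} [Fintype ι] {φ : ι → Ω → ℂ} (hφ : ∀ i x, ‖φ i x‖ = 1)
    (a : ι → ℂ) (x : Ω) : ‖∑ i, a i * φ i x‖ ≤ supNorm φ a :=
  le_csSup (bddAbove_supNorm hφ a) ⟨x, rfl⟩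

/-- Flipping the i-th sign changes the sum by a term of modulus 2|a_i|, so the two suprema average
to at least |a_i|. This pays for the largest coefficient, which the blocks leave over. -/
lemma norm_le_expect_supNorm [Nonempty Ω] {ι : Type*} [Fintype ι] [DecidableEq ι] {φ : ι → Ω → ℂ}
    (hφ : ∀ i x, ‖φ i x‖ = 1) (a : ι → ℂ) (i : ι) :
    ‖a i‖ ≤ 𝔼 ω : ι → Bool, supNorm φ (fun i => boolSign (ω i) * a i) := by
  obtain ⟨x⟩ := ‹Nonempty Ω›
  rw [expect_eq_half i]
  refine Finset.le_expect Finset.univ_nonempty fun ω _ => ?_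
  have h1 := norm_sum_le_supNorm hφ (fun i => boolSign (ω i) * a i) x
  have h2 := norm_sum_le_supNorm hφ (fun k => boolSign (flipAt i ω k) * a k) x
  have h3 := norm_sub_le (∑ k, boolSign (ω k) * a k * φ k x)
    (∑ k, boolSign (flipAt i ω k) * a k * φ k x)
  rw [← Finset.sum_sub_distrib, Finset.sum_eq_single i] at h3
  · rw [flipAt_self, boolSign_not] at h3
    have e : (boolSign (ω i) : ℂ) * a i * φ i x - ((-boolSign (ω i) : ℝ) : ℂ) * a i * φ i x =
        2 * ((boolSign (ω i) : ℂ) * (a i * φ i x)) := by push_cast; ring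
    rw [e, norm_mul, norm_mul, norm_mul, hφ, Complex.norm_real, Real.norm_eq_abs, abs_boolSign] at h3
    simp only [Complex.norm_ofNat, one_mul, mul_one] at h3
    linarith
  · intro k _ hk
    rw [flipAt_of_ne hk, sub_self]
  · simp

lemma exists_unimodular_mul_norm (z : ℂ) : ∃ u : ℂ, ‖u‖ = 1 ∧ z = ‖z‖ * u := by
  by_cases h : z = 0
  · exact ⟨1, by simp, by simp [h]⟩
  · have h' : (‖z‖ : ℂ) ≠ 0 := by simpa using h
    refine ⟨z / ‖z‖, ?_, ?_⟩
    · rw [norm_div, Complex.norm_real, norm_norm, div_self (norm_ne_zero_iff.2 h)]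
    · field_simp

/-- Rademacher–Sidon property of subgaussian systems of unimodular functions. -/
theorem sum_norm_le_expect_supNorm [MeasurableSpace Ω] (μ : Measure Ω) [IsProbabilityMeasure μ]
    {ι : Type*} [Fintype ι] [DecidableEq ι] {φ : ι → Ω → ℂ} (hφm : ∀ i, Measurable (φ i))
    (hφ : ∀ i x, ‖φ i x‖ = 1) {D : ℝ} (hD : 1 ≤ D)
    (hmgf : ∀ (T : Finset ι) (c : ι → ℂ), ∫ x, Real.exp (∑ i ∈ T, c i * φ i x).re ∂μ ≤
      2 * Real.exp (D * ∑ i ∈ T, ‖c i‖ ^ 2)) {R : ℕ} (hR : 2000 * D + 1 ≤ R) (a : ι → ℂ) :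
    ∑ i, ‖a i‖ ≤ R * (1 + 1200 * D) *
      𝔼 ω : ι → Bool, supNorm φ (fun i => boolSign (ω i) * a i) := by
  have hΩ : Nonempty Ω := by
    by_contra h
    rw [not_nonempty_iff] at h
    have := measure_univ (μ := μ)
    rw [Set.univ_eq_empty_iff.2 h, measure_empty] at this
    exact zero_ne_one this
  rcases isEmpty_or_nonempty ι with hι | hι
  · have h0 : (0 : ℝ) ≤ 𝔼 ω : ι → Bool, supNorm φ (fun i => boolSign (ω i) * a i) := by
      refine Finset.expect_nonneg fun ω _ => ?_
      obtain ⟨x⟩ := hΩ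
      exact (norm_nonneg _).trans (norm_sum_le_supNorm hφ _ x)
    simp only [Finset.univ_eq_empty, Finset.sum_empty]
    positivity
  set E := 𝔼 ω : ι → Bool, supNorm φ (fun i => boolSign (ω i) * a i) with hE
  have hD0 : 0 < D := by linarith
  have hR2 : 2 ≤ R := by
    have : (2 : ℝ) ≤ R := by linarith
    exact_mod_cast this
  choose u hu hau using fun i => exists_unimodular_mul_norm (a i)
  obtain ⟨K, T, w, i₀, hcard, hdisj, hw, hwa, hsum⟩ :=
    exists_geometric_blocks (fun i => ‖a i‖) (fun i => norm_nonneg _) hR2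
  -- Phases are absorbed into u. Real and imaginary parts are separate functions, with independent
  -- signs, so that their squares sum at every point to the cardinality of T k.
  set g : ι ⊕ ι → Ω → ℝ :=
    Sum.elim (fun i x => (u i * φ i x).re) (fun i x => (u i * φ i x).im) with hg
  have hunorm : ∀ i x, ‖u i * φ i x‖ = 1 := fun i x => by rw [norm_mul, hu, hφ, one_mul]
  have hg1 : ∀ j x, |g j x| ≤ 1 := by
    rintro (i | i) x
    · exact (Complex.abs_re_le_norm _).trans (hunorm i x).le
    · exact (Complex.abs_im_le_norm _).trans (hunorm i x).le
  have hgb : ∀ j, BddMeas (g j) := by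
    rintro (i | i)
    · exact ⟨Complex.measurable_re.comp ((hφm i).const_mul _), 1, hg1 (Sum.inl i)⟩
    · exact ⟨Complex.measurable_im.comp ((hφm i).const_mul _), 1, hg1 (Sum.inr i)⟩
  set n : ℕ → ℝ := fun k => (R : ℝ) ^ k * (R - 1) with hn
  have hnT : ∀ k < K, ((T k).card : ℝ) = n k := by
    intro k hk
    rw [hcard k hk, hn]
    push_cast [Nat.cast_sub (by omega : 1 ≤ R)]
    rfl
  set A : ℕ → Finset (ι ⊕ ι) := fun k => (T k).disjSum (T k) with hA
  have hRk : ∀ k, (1 : ℝ) ≤ (R : ℝ) ^ k := fun k => one_le_pow₀ (by linarith)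
  -- the lower bound coming from the blocks
  have hblocks := expect_sSup_blocks_ge μ hgb hg1 hD (K := K) (A := A) (n := n) (w := w)
    (by
      intro k l hkl
      rw [Finset.disjoint_left]
      have := Finset.disjoint_left.1 (hdisj k l hkl)
      rintro (i | i) hi hi'
      · exact this (Finset.inl_mem_disjSum.1 hi) (Finset.inl_mem_disjSum.1 hi')
      · exact this (Finset.inr_mem_disjSum.1 hi) (Finset.inr_mem_disjSum.1 hi'))
    hw
    (by
      intro k _
      have := hRk k
      simp only [hn]
      nlinarith)
    (by
      intro k
      have := hRk k
      have h1 : (0 : ℝ) ≤ (R : ℝ) ^ k * (R - 1) := mul_nonneg (by linarith) (by linarith)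
      simp only [hn, pow_succ]
      nlinarith)
    (by
      intro k hk
      rw [hA, Finset.card_disjSum]
      push_cast
      rw [hnT k hk]; ring)
    (by
      intro k hk x
      rw [hA, Finset.sum_disjSum, ← Finset.sum_add_distrib, ← hnT k hk]
      rw [Finset.sum_congr rfl (g := fun _ => (1 : ℝ))]
      · simp
      · intro i _
        have := hunorm i x
        simp only [hg, Sum.elim_inl, Sum.elim_inr]
        rw [← Complex.sq_norm_sub_sq_re, this]
        ring)
    (by
      intro k hk b
      -- Re((b - b' i) z) = b Re z + b' Im z turns a real combination of the g_j into the real part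
      -- of a combination of the φ_i.
      have h := hmgf (T k) (fun i => (b (Sum.inl i) - b (Sum.inr i) * Complex.I) * u i)
      have e1 : ∀ x, (∑ i ∈ T k, ((b (Sum.inl i) - b (Sum.inr i) * Complex.I) * u i) * φ i x).re =
          ∑ j ∈ A k, b j * g j x := by
        intro x
        rw [hA, Finset.sum_disjSum, ← Finset.sum_add_distrib, Complex.re_sum]
        refine Finset.sum_congr rfl fun i _ => ?_
        simp only [hg, Sum.elim_inl, Sum.elim_inr]
        rw [mul_assoc]
        simp [Complex.mul_re, Complex.sub_re, Complex.sub_im]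
      have e2 : ∑ i ∈ T k, ‖((b (Sum.inl i) : ℂ) - b (Sum.inr i) * Complex.I) * u i‖ ^ 2 =
          ∑ j ∈ A k, b j ^ 2 := by
        rw [hA, Finset.sum_disjSum, ← Finset.sum_add_distrib]
        refine Finset.sum_congr rfl fun i _ => ?_
        rw [norm_mul, hu, mul_one, Complex.sq_norm, Complex.normSq_apply]
        simp
        ring
      simp_rw [e1] at h
      rwa [e2] at h)
    K 0 (zero_add K) MeasurableSet.univ
    (by
      rw [measureReal_def, measure_univ, ENNReal.toReal_one]
      refine Real.exp_le_one_iff.2 ?_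
      rw [neg_nonpos]
      have := hRk 0
      simp only [hn]
      exact div_nonneg (mul_nonneg (by linarith) (by linarith)) (by positivity))
  -- contraction
  set c : ι → ℝ := fun i => ∑ k ∈ Finset.range K, if i ∈ T k then w k else 0 with hc
  have hc0 : ∀ i, 0 ≤ c i := fun i => Finset.sum_nonneg fun k _ => by
    split_ifs
    · exact hw k
    · exact le_rfl
  have hca : ∀ i, c i ≤ ‖a i‖ := by
    intro i
    by_cases h : ∃ k ∈ Finset.range K, i ∈ T k
    · obtain ⟨k, hk, hik⟩ := h
      rw [hc]
      simp only
      rw [Finset.sum_eq_single_of_mem k hk, if_pos hik]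
      · exact hwa k i hik
      · intro l _ hl
        rw [if_neg]
        exact Finset.disjoint_left.1 (hdisj k l (Ne.symm hl)) hik
    · push Not at h
      rw [hc]
      simp only
      rw [Finset.sum_eq_zero fun k hk => if_neg (h k hk)]
      exact norm_nonneg _
  set α : ι ⊕ ι → ℝ := Sum.elim (fun i => ‖a i‖) (fun i => ‖a i‖) with hα
  set γ : ι ⊕ ι → ℝ := Sum.elim c c with hγ
  have hγα : ∀ j, 0 ≤ γ j ∧ γ j ≤ α j := by
    rintro (i | i)
    · exact ⟨hc0 i, hca i⟩
    · exact ⟨hc0 i, hca i⟩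
  have hθ : ∀ j, |γ j / α j| ≤ 1 := by
    intro j
    have := hγα j
    rw [abs_of_nonneg (div_nonneg this.1 (this.1.trans this.2))]
    exact div_le_one_of_le₀ this.2 (this.1.trans this.2)
  -- If α j = 0, the quotient is 0 by convention, and γ j = 0 as well since 0 ≤ γ j ≤ α j.
  have hθα : ∀ j, γ j / α j * α j = γ j := by
    intro j
    by_cases h : α j = 0
    · have := hγα j
      rw [h] at this ⊢
      linarith
    · field_simp
  obtain ⟨hbdd, hconv⟩ := convexOn_sSup_range_linear (fun j x => α j * g j x)
    (fun j => ⟨|α j|, fun x => by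
      rw [abs_mul]; exact mul_le_of_le_one_right (abs_nonneg _) (hg1 j x)⟩)
  have hcontr := expect_contraction hconv hθ
  have hblock_eq : ∀ (ω : ι ⊕ ι → Bool) x, ∑ j, boolSign (ω j) * (γ j / α j) * (α j * g j x) =
      ∑ k ∈ Finset.Ico 0 K, w k * ∑ j ∈ A k, boolSign (ω j) * g j x := by
    intro ω x
    have e1 : ∀ j, boolSign (ω j) * (γ j / α j) * (α j * g j x) =
        γ j * (boolSign (ω j) * g j x) := by
      intro j
      calc _ = (γ j / α j * α j) * (boolSign (ω j) * g j x) := by ring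
        _ = _ := by rw [hθα]
    simp_rw [e1]
    rw [Fintype.sum_sum_type, ← Finset.sum_add_distrib, ← Finset.range_eq_Ico]
    simp only [hγ, Sum.elim_inl, Sum.elim_inr, hA, Finset.sum_disjSum, ← Finset.sum_add_distrib,
      ← mul_add, hc, Finset.sum_mul]
    rw [Finset.sum_comm]
    refine Finset.sum_congr rfl fun k _ => ?_
    simp_rw [ite_mul, zero_mul]
    rw [← Finset.sum_filter, Finset.filter_univ_mem, Finset.mul_sum]
  simp_rw [hblock_eq] at hcontr
  -- comparison with the moduli
  have hup : (𝔼 ω : ι ⊕ ι → Bool, sSup (Set.range fun x =>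
      ∑ j, boolSign (ω j) * (α j * g j x))) ≤ 2 * E := by
    rw [expect_sum_cube]
    -- The sum is the real part of the η-sum plus the imaginary part of the η'-sum, whence the
    -- factor 2.
    have hpt : ∀ η η' : ι → Bool, sSup (Set.range fun x =>
        ∑ j, boolSign (Sum.elim η η' j) * (α j * g j x)) ≤
        supNorm φ (fun i => boolSign (η i) * a i) + supNorm φ (fun i => boolSign (η' i) * a i) := by
      intro η η'
      refine csSup_le (Set.range_nonempty _) ?_
      rintro _ ⟨x, rfl⟩
      refine le_trans ?_ (add_le_add (norm_sum_le_supNorm hφ _ x) (norm_sum_le_supNorm hφ _ x))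
      refine le_trans (le_of_eq ?_) (add_le_add (Complex.re_le_norm _) (Complex.abs_im_le_norm _ |>.trans' (le_abs_self _)))
      simp only
      rw [Fintype.sum_sum_type, Complex.re_sum, Complex.im_sum]
      have e : ∀ i, a i * φ i x = ‖a i‖ * (u i * φ i x) := fun i => by
        rw [← mul_assoc, ← hau]
      simp_rw [mul_assoc, e, Complex.re_ofReal_mul, Complex.im_ofReal_mul]
      rfl
    calc _ ≤ 𝔼 η : ι → Bool, 𝔼 η' : ι → Bool, (supNorm φ (fun i => boolSign (η i) * a i) +
          supNorm φ (fun i => boolSign (η' i) * a i)) :=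
          Finset.expect_le_expect fun η _ => Finset.expect_le_expect fun η' _ => hpt η η'
      _ = 2 * E := by
          simp_rw [Finset.expect_add_distrib, Fintype.expect_const]
          rw [← hE]; ring
  simp_rw [Set.image_univ] at hblocks
  have hS := (hblocks.trans hcontr).trans hup
  rw [div_le_iff₀ (by positivity), ← Finset.range_eq_Ico] at hS
  have hi₀ := norm_le_expect_supNorm hφ a i₀
  rw [← hE] at hi₀
  have hn' : ∀ k, ((R ^ k * (R - 1) : ℕ) : ℝ) = n k := by
    intro k
    rw [hn]
    push_cast [Nat.cast_sub (by omega : 1 ≤ R)]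
    rfl
  simp_rw [hn'] at hsum
  have hR0 : (0 : ℝ) ≤ R := Nat.cast_nonneg R
  calc _ ≤ _ := hsum
    _ ≤ R * E + R * (2 * E * (600 * D)) :=
      add_le_add (mul_le_mul_of_nonneg_left hi₀ hR0) (mul_le_mul_of_nonneg_left hS hR0)
    _ = _ := by ring

end RademacherSidon

/-! ### Subgaussian bounds from the two hypotheses. -/

section Subgaussian

variable {ι Ω : Type*} [MeasurableSpace Ω] {φ : ι → Ω → ℂ} {μ : Measure Ω}

lemma BddMeas.norm_sum (hφm : ∀ i, Measurable (φ i)) (hφ : ∀ i x, ‖φ i x‖ = 1) (T : Finset ι)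
    (c : ι → ℂ) : BddMeas (fun x => ‖∑ i ∈ T, c i * φ i x‖) := by
  refine ⟨(Finset.measurable_sum T fun i _ => (hφm i).const_mul _).norm, ∑ i ∈ T, ‖c i‖,
    fun x => ?_⟩
  rw [abs_norm]
  refine (norm_sum_le _ _).trans (Finset.sum_le_sum fun i _ => ?_)
  rw [norm_mul, hφ, mul_one]

/-- An exponential square integrability bound yields a subgaussian moment generating function. -/
lemma integral_exp_re_le_of_exp_sq [IsProbabilityMeasure μ] (hφm : ∀ i, Measurable (φ i))
    (hφ : ∀ i x, ‖φ i x‖ = 1) {κ : ℝ} (hκ : 0 < κ) (T : Finset ι) (c : ι → ℂ)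
    (h : 0 < Real.sqrt (∑ i ∈ T, ‖c i‖ ^ 2) →
      ∫ x, Real.exp ((‖∑ i ∈ T, c i * φ i x‖ / (κ * Real.sqrt (∑ i ∈ T, ‖c i‖ ^ 2))) ^ 2) ∂μ ≤ 2) :
    ∫ x, Real.exp (∑ i ∈ T, c i * φ i x).re ∂μ ≤
      2 * Real.exp (κ ^ 2 / 4 * ∑ i ∈ T, ‖c i‖ ^ 2) := by
  have hS0 : 0 ≤ ∑ i ∈ T, ‖c i‖ ^ 2 := Finset.sum_nonneg fun i _ => sq_nonneg _
  rcases hS0.eq_or_lt with hS | hS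
  · have hc : ∀ i ∈ T, c i = 0 := by
      intro i hi
      have := (Finset.sum_eq_zero_iff_of_nonneg fun i _ => sq_nonneg ‖c i‖).1 hS.symm i hi
      simpa using this
    have h0 : ∀ x, ∑ i ∈ T, c i * φ i x = 0 := fun x =>
      Finset.sum_eq_zero fun i hi => by rw [hc i hi, zero_mul]
    simp_rw [h0, ← hS]
    simp
  · set N := Real.sqrt (∑ i ∈ T, ‖c i‖ ^ 2) with hN
    have hN0 : 0 < N := Real.sqrt_pos.2 hS
    have hNS : N ^ 2 = ∑ i ∈ T, ‖c i‖ ^ 2 := Real.sq_sqrt hS0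
    have hb := BddMeas.norm_sum hφm hφ T c
    have hE : BddMeas (fun x => Real.exp ((‖∑ i ∈ T, c i * φ i x‖ / (κ * N)) ^ 2)) := by
      have := ((hb.const_mul (κ * N)⁻¹).pow 2).exp
      simpa only [div_eq_inv_mul] using this
    have hre : BddMeas (fun x => Real.exp (∑ i ∈ T, c i * φ i x).re) := by
      refine BddMeas.exp ⟨Complex.measurable_re.comp
        (Finset.measurable_sum T fun i _ => (hφm i).const_mul _), ?_⟩
      obtain ⟨-, M, hM⟩ := hb
      exact ⟨M, fun x => (Complex.abs_re_le_norm _).trans ((le_abs_self _).trans (hM x))⟩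
    calc _ ≤ ∫ x, Real.exp (κ ^ 2 / 4 * N ^ 2) *
          Real.exp ((‖∑ i ∈ T, c i * φ i x‖ / (κ * N)) ^ 2) ∂μ := by
          refine integral_mono (hre.integrable μ) ((hE.const_mul _).integrable μ) fun x => ?_
          simp only
          rw [← Real.exp_add]
          refine Real.exp_le_exp.2 ((Complex.re_le_norm _).trans ?_)
          set t := ‖∑ i ∈ T, c i * φ i x‖ with ht
          have e : t = t / (κ * N) * (κ * N) := by field_simp
          nlinarith [sq_nonneg (t / (κ * N) - κ * N / 2)]
      _ = Real.exp (κ ^ 2 / 4 * N ^ 2) *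
          ∫ x, Real.exp ((‖∑ i ∈ T, c i * φ i x‖ / (κ * N)) ^ 2) ∂μ := integral_const_mul _ _
      _ ≤ Real.exp (κ ^ 2 / 4 * N ^ 2) * 2 :=
          mul_le_mul_of_nonneg_left (h hN0) (Real.exp_pos _).le
      _ = _ := by rw [hNS, mul_comm]

/-- The infimum defining the norm need not be attained, so the constant is enlarged strictly to
obtain an admissible K below it. The factor 6 is only there to match the Rudin case. -/
lemma Psi2Condition.integral_exp_sq_le [IsProbabilityMeasure μ] {C : ℝ} (hC : 0 < C)
    (hψ : Psi2Condition φ μ C) (hφm : ∀ i, Measurable (φ i))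
    (hφ : ∀ i x, ‖φ i x‖ = 1) (T : Finset ι) (c : ι → ℂ)
    (hN : 0 < Real.sqrt (∑ i ∈ T, ‖c i‖ ^ 2)) :
    ∫ x, Real.exp ((‖∑ i ∈ T, c i * φ i x‖ /
      (6 * C * Real.sqrt (∑ i ∈ T, ‖c i‖ ^ 2))) ^ 2) ∂μ ≤ 2 := by
  set N := Real.sqrt (∑ i ∈ T, ‖c i‖ ^ 2) with hNdef
  have h1 : psi2Norm (fun x => ∑ j ∈ T, c j * φ j x) μ < ENNReal.ofReal (6 * C * N) :=
    (hψ T c).trans_lt ((ENNReal.ofReal_lt_ofReal_iff (by positivity)).2 (by nlinarith [mul_pos hC hN]))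
  unfold psi2Norm at h1
  simp only [iInf_lt_iff] at h1
  obtain ⟨K, hK, hint, hlt⟩ := h1
  have hK6 : (K : ℝ) < 6 * C * N := by
    rw [ENNReal.lt_ofReal_iff_toReal_lt ENNReal.coe_ne_top] at hlt
    simpa using hlt
  have hb := BddMeas.norm_sum hφm hφ T c
  have hE : BddMeas (fun x => Real.exp ((‖∑ i ∈ T, c i * φ i x‖ / (6 * C * N)) ^ 2)) := by
    have := ((hb.const_mul (6 * C * N)⁻¹).pow 2).exp
    simpa only [div_eq_inv_mul] using this
  have hle : ∫⁻ x, ENNReal.ofReal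
      (Real.exp ((‖∑ i ∈ T, c i * φ i x‖ / (6 * C * N)) ^ 2) - 1) ∂μ ≤ 1 := by
    refine le_trans (lintegral_mono fun x => ENNReal.ofReal_le_ofReal ?_) hint
    refine sub_le_sub_right (Real.exp_le_exp.2 ?_) 1
    have hK' : (0 : ℝ) < K := by exact_mod_cast hK
    gcongr
  rw [← ofReal_integral_eq_lintegral_ofReal ((hE.sub (BddMeas.const 1)).integrable μ)
    (Filter.Eventually.of_forall fun x => by
      have := Real.one_le_exp (sq_nonneg (‖∑ i ∈ T, c i * φ i x‖ / (6 * C * N)))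
      simpa using this),
    ENNReal.ofReal_le_one, integral_sub (hE.integrable μ) (integrable_const _)] at hle
  simp only [integral_const, probReal_univ, smul_eq_mul, mul_one] at hle
  linarith

/-- Rudin's condition excludes p = 2, which would be needed for m = 1. The exponent 4m is used
instead, L^p norms being increasing in p on a probability space. -/
lemma RudinCondition.lintegral_pow_le [IsProbabilityMeasure μ] {C : ℝ} (hC : 0 < C)
    (hR : RudinCondition φ μ C) (hφm : ∀ i, Measurable (φ i)) (T : Finset ι) (c : ι → ℂ)
    {m : ℕ} (hm : 1 ≤ m) :
    ∫⁻ x, ENNReal.ofReal (‖∑ i ∈ T, c i * φ i x‖ ^ (2 * m)) ∂μ ≤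
      ENNReal.ofReal ((4 * m * C ^ 2 * ∑ i ∈ T, ‖c i‖ ^ 2) ^ m) := by
  have hm1 : (1 : ℝ) ≤ m := by exact_mod_cast hm
  have hS0 : 0 ≤ ∑ i ∈ T, ‖c i‖ ^ 2 := Finset.sum_nonneg fun i _ => sq_nonneg _
  have hmeas : Measurable (fun x => ∑ i ∈ T, c i * φ i x) :=
    Finset.measurable_sum T fun i _ => (hφm i).const_mul _
  have h1 : eLpNorm (fun x => ∑ i ∈ T, c i * φ i x) (2 * m : ℕ) μ ≤
      ENNReal.ofReal (C * Real.sqrt (4 * m) * Real.sqrt (∑ i ∈ T, ‖c i‖ ^ 2)) := by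
    refine le_trans (eLpNorm_le_eLpNorm_of_exponent_le ?_ hmeas.aestronglyMeasurable)
      (hR (4 * m) (by linarith) T c)
    rw [← ENNReal.ofReal_natCast]
    refine ENNReal.ofReal_le_ofReal ?_
    push_cast
    linarith
  have h2 := eLpNorm_nnreal_pow_eq_lintegral (μ := μ) (p := ((2 * m : ℕ) : ℝ≥0))
    (f := fun x => ∑ i ∈ T, c i * φ i x) (by positivity)
  have h3 : ∫⁻ x, ENNReal.ofReal (‖∑ i ∈ T, c i * φ i x‖ ^ (2 * m)) ∂μ =
      ∫⁻ x, ‖∑ i ∈ T, c i * φ i x‖ₑ ^ (((2 * m : ℕ) : ℝ≥0) : ℝ) ∂μ := by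
    refine lintegral_congr fun x => ?_
    rw [NNReal.coe_natCast, ENNReal.rpow_natCast, ENNReal.ofReal_pow (norm_nonneg _), ofReal_norm]
  rw [h3, ← h2, NNReal.coe_natCast, ENNReal.rpow_natCast]
  refine (pow_le_pow_left₀ (zero_le) h1 _).trans ?_
  rw [← ENNReal.ofReal_pow (by positivity)]
  refine ENNReal.ofReal_le_ofReal (le_of_eq ?_)
  rw [pow_mul, mul_pow, mul_pow C, Real.sq_sqrt (by positivity), Real.sq_sqrt hS0]
  ring

/-- Expand the exponential. By the moment bound and m^m ≤ e^m m! ≤ (9/2)^m m!, the m-th term is at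
most (4 · (9/2) / 36)^m = 2^(-m), and these sum to 2. -/
lemma RudinCondition.integral_exp_sq_le [IsProbabilityMeasure μ] {C : ℝ} (hC : 0 < C)
    (hR : RudinCondition φ μ C) (hφm : ∀ i, Measurable (φ i))
    (hφ : ∀ i x, ‖φ i x‖ = 1) (T : Finset ι) (c : ι → ℂ)
    (hN : 0 < Real.sqrt (∑ i ∈ T, ‖c i‖ ^ 2)) :
    ∫ x, Real.exp ((‖∑ i ∈ T, c i * φ i x‖ /
      (6 * C * Real.sqrt (∑ i ∈ T, ‖c i‖ ^ 2))) ^ 2) ∂μ ≤ 2 := by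
  set N := Real.sqrt (∑ i ∈ T, ‖c i‖ ^ 2) with hNdef
  have hS0 : 0 ≤ ∑ i ∈ T, ‖c i‖ ^ 2 := Finset.sum_nonneg fun i _ => sq_nonneg _
  have hNS : ∑ i ∈ T, ‖c i‖ ^ 2 = N ^ 2 := (Real.sq_sqrt hS0).symm
  have hb := BddMeas.norm_sum hφm hφ T c
  have hE : BddMeas (fun x => Real.exp ((‖∑ i ∈ T, c i * φ i x‖ / (6 * C * N)) ^ 2)) := by
    have := ((hb.const_mul (6 * C * N)⁻¹).pow 2).exp
    simpa only [div_eq_inv_mul] using this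
  have hterm : ∀ m : ℕ, ∫⁻ x, ENNReal.ofReal
      (((‖∑ i ∈ T, c i * φ i x‖ / (6 * C * N)) ^ 2) ^ m / m.factorial) ∂μ ≤
      ENNReal.ofReal ((1 / 2) ^ m) := by
    intro m
    rcases Nat.eq_zero_or_pos m with rfl | hm
    · simp
    · have hden : 0 < (6 * C * N) ^ (2 * m) * m.factorial := by positivity
      have e1 : ∀ x, ENNReal.ofReal
          (((‖∑ i ∈ T, c i * φ i x‖ / (6 * C * N)) ^ 2) ^ m / m.factorial) =
          ENNReal.ofReal ((6 * C * N) ^ (2 * m) * m.factorial)⁻¹ *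
            ENNReal.ofReal (‖∑ i ∈ T, c i * φ i x‖ ^ (2 * m)) := by
        intro x
        rw [← ENNReal.ofReal_mul (by positivity), ← pow_mul, div_pow]
        congr 1
        field_simp
      simp_rw [e1]
      rw [lintegral_const_mul' _ _ ENNReal.ofReal_ne_top]
      refine (mul_le_mul_right (hR.lintegral_pow_le hC hφm T c hm) _).trans ?_
      rw [← ENNReal.ofReal_mul (by positivity)]
      refine ENNReal.ofReal_le_ofReal ?_
      rw [inv_mul_le_iff₀ hden, hNS]
      have hfac := Real.pow_div_factorial_le_exp (m : ℝ) (Nat.cast_nonneg m) m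
      rw [div_le_iff₀ (by positivity)] at hfac
      have hexp : Real.exp m ≤ (9 / 2) ^ m := by
        have : Real.exp m = Real.exp 1 ^ m := by rw [← Real.exp_nat_mul, mul_one]
        rw [this]
        exact pow_le_pow_left₀ (Real.exp_pos _).le (by linarith [Real.exp_one_lt_d9]) _
      calc (4 * m * C ^ 2 * N ^ 2) ^ m = (4 * C ^ 2 * N ^ 2) ^ m * (m : ℝ) ^ m := by
            rw [← mul_pow]; congr 1; ring
        _ ≤ (4 * C ^ 2 * N ^ 2) ^ m * ((9 / 2) ^ m * m.factorial) := by
            refine mul_le_mul_of_nonneg_left (hfac.trans ?_) (by positivity)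
            exact mul_le_mul_of_nonneg_right hexp (by positivity)
        _ = _ := by
            rw [pow_mul, ← mul_assoc, ← mul_pow, mul_right_comm _ _ ((1 / 2 : ℝ) ^ m), ← mul_pow]
            congr 2; ring
  have hexpand : ∀ x, ENNReal.ofReal
      (Real.exp ((‖∑ i ∈ T, c i * φ i x‖ / (6 * C * N)) ^ 2)) =
      ∑' m : ℕ, ENNReal.ofReal
        (((‖∑ i ∈ T, c i * φ i x‖ / (6 * C * N)) ^ 2) ^ m / m.factorial) := by
    intro x
    rw [Real.exp_eq_exp_ℝ, NormedSpace.exp_eq_tsum_div]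
    exact ENNReal.ofReal_tsum_of_nonneg (fun m => by positivity)
      (NormedSpace.expSeries_div_summable _)
  have hle : ∫⁻ x, ENNReal.ofReal
      (Real.exp ((‖∑ i ∈ T, c i * φ i x‖ / (6 * C * N)) ^ 2)) ∂μ ≤ ENNReal.ofReal 2 := by
    simp_rw [hexpand]
    rw [lintegral_tsum fun m => ?_]
    · refine (ENNReal.tsum_le_tsum hterm).trans (le_of_eq ?_)
      rw [← ENNReal.ofReal_tsum_of_nonneg (fun m => by positivity) summable_geometric_two,
        tsum_geometric_two]
    · refine (Measurable.ennreal_ofReal ?_).aemeasurable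
      exact (((hb.1.div_const _).pow_const 2).pow_const m).div_const _
  rw [← ofReal_integral_eq_lintegral_ofReal (hE.integrable μ)
    (Filter.Eventually.of_forall fun x => (Real.exp_pos _).le)] at hle
  exact (ENNReal.ofReal_le_ofReal_iff (by norm_num)).1 hle

lemma Psi2Condition.mono {C C' : ℝ} (h : Psi2Condition φ μ C) (hC : C ≤ C') :
    Psi2Condition φ μ C' := fun s a => (h s a).trans
  (ENNReal.ofReal_le_ofReal (mul_le_mul_of_nonneg_right hC (Real.sqrt_nonneg _)))

lemma RudinCondition.mono {C C' : ℝ} (h : RudinCondition φ μ C) (hC : C ≤ C') :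
    RudinCondition φ μ C' := fun p hp s a => (h p hp s a).trans
  (ENNReal.ofReal_le_ofReal (by gcongr))

end Subgaussian

/-! ### Walsh expansions on the cube. -/

section Walsh

variable {ι : Type*} [Fintype ι] [DecidableEq ι]

/-- The Walsh coefficient of a function on the cube. -/
noncomputable def walshCoeff (v : (ι → Bool) → ℂ) (S : Finset ι) : ℂ :=
  𝔼 ω, (∏ k ∈ S, (boolSign (ω k) : ℂ)) * v ω

/-- Expanding the product over subsets S separates ω from ω'. -/
lemma expect_expect_riesz (r : ι → ℂ) (v v' : (ι → Bool) → ℂ) :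
    𝔼 ω, 𝔼 ω', (∏ k, (1 + r k * (boolSign (ω k) * boolSign (ω' k)))) * (v ω * v' ω') =
      ∑ S : Finset ι, (∏ k ∈ S, r k) * (walshCoeff v S * walshCoeff v' S) := by
  simp_rw [Finset.prod_one_add, Finset.powerset_univ, Finset.sum_mul]
  simp_rw [Finset.expect_sum_comm]
  refine Finset.sum_congr rfl fun S _ => ?_
  unfold walshCoeff
  rw [Finset.expect_mul_expect, Finset.mul_expect]
  refine Finset.expect_congr rfl fun ω _ => ?_
  rw [Finset.mul_expect]
  refine Finset.expect_congr rfl fun ω' _ => ?_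
  rw [Finset.prod_mul_distrib, Finset.prod_mul_distrib]
  ring

lemma prod_one_add_boolSign (ω ω' : ι → Bool) :
    ∏ k, (1 + (1 : ℂ) * (boolSign (ω k) * boolSign (ω' k))) =
      if ω = ω' then (Fintype.card (ι → Bool) : ℂ) else 0 := by
  split_ifs with h
  · subst h
    have : ∀ k, (1 + (1 : ℂ) * (boolSign (ω k) * boolSign (ω k))) = 2 := by
      intro k
      rw [one_mul, ← Complex.ofReal_mul, boolSign_mul_self]
      norm_num
    simp_rw [this]
    simp
  · obtain ⟨k, hk⟩ := Function.ne_iff.1 h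
    refine Finset.prod_eq_zero (Finset.mem_univ k) ?_
    have : ω' k = !ω k := by
      cases h1 : ω k <;> cases h2 : ω' k <;> simp_all
    rw [this, boolSign_not, one_mul, ← Complex.ofReal_mul, mul_neg, boolSign_mul_self]
    norm_num

/-- Parseval, read off from the Riesz kernel with all r_k = 1, which is the number of points of the
cube times the indicator of the diagonal. -/
lemma sum_norm_sq_walshCoeff_le (v : (ι → Bool) → ℂ) (hv : ∀ ω, ‖v ω‖ ≤ 1) :
    ∑ S : Finset ι, ‖walshCoeff v S‖ ^ 2 ≤ 1 := by
  have h := expect_expect_riesz (fun _ => 1) v (fun ω => (starRingEnd ℂ) (v ω))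
  have hconj : ∀ S, walshCoeff (fun ω => (starRingEnd ℂ) (v ω)) S =
      (starRingEnd ℂ) (walshCoeff v S) := by
    intro S
    unfold walshCoeff
    rw [map_expect]
    refine Finset.expect_congr rfl fun ω _ => ?_
    rw [map_mul, map_prod]
    simp
  simp_rw [prod_one_add_boolSign, hconj, Complex.mul_conj, Finset.prod_const_one, one_mul] at h
  have h2 : (𝔼 ω : ι → Bool, 𝔼 ω' : ι → Bool, (if ω = ω' then (Fintype.card (ι → Bool) : ℂ) else 0) *
      (v ω * (starRingEnd ℂ) (v ω'))) = 𝔼 ω : ι → Bool, ((‖v ω‖ ^ 2 : ℝ) : ℂ) := by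
    refine Finset.expect_congr rfl fun ω _ => ?_
    rw [Fintype.expect_eq_sum_div_card]
    simp_rw [ite_mul, zero_mul]
    rw [Finset.sum_ite_eq Finset.univ ω, if_pos (Finset.mem_univ _), Complex.mul_conj,
      Complex.normSq_eq_norm_sq, mul_div_assoc, mul_comm]
    exact div_mul_cancel₀ _ (Nat.cast_ne_zero.2 Fintype.card_ne_zero)
  rw [h2] at h
  simp_rw [Complex.normSq_eq_norm_sq] at h
  have h3 : (𝔼 ω : ι → Bool, ‖v ω‖ ^ 2) = ∑ S : Finset ι, ‖walshCoeff v S‖ ^ 2 := by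
    have := congrArg Complex.re h
    rw [← Complex.ofReal_sum, Complex.ofReal_re] at this
    rw [← this]
    have := Complex.ofReal_expect (Finset.univ) (fun ω : ι → Bool => ‖v ω‖ ^ 2)
    rw [← this, Complex.ofReal_re]
  rw [← h3]
  exact Finset.expect_le Finset.univ_nonempty
    fun ω _ => pow_le_one₀ (norm_nonneg _) (hv ω)

end Walsh

/-! ### The polar of the sup norm and duality. -/

section PolarBall

variable {ι Ω : Type*} [Fintype ι] {φ : ι → Ω → ℂ}

/-- The sequences dominated, as functionals, by the uniform norm of the system `φ`. -/
def polarBall (φ : ι → Ω → ℂ) : Set (ι → ℂ) := {ψ | ∀ a : ι → ℂ, ‖∑ i, a i * ψ i‖ ≤ supNorm φ a}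

lemma convex_polarBall : Convex ℝ (polarBall φ) := by
  intro ψ hψ ψ' hψ' s t hs ht hst a
  have e : ∑ i, a i * (s • ψ + t • ψ') i = s * ∑ i, a i * ψ i + t * ∑ i, a i * ψ' i := by
    rw [Finset.mul_sum, Finset.mul_sum, ← Finset.sum_add_distrib]
    refine Finset.sum_congr rfl fun i _ => ?_
    simp only [Pi.add_apply, Pi.smul_apply, Complex.real_smul]
    ring
  rw [e]
  refine (norm_add_le _ _).trans ?_
  rw [norm_mul, norm_mul, Complex.norm_of_nonneg hs, Complex.norm_of_nonneg ht]
  calc _ ≤ s * supNorm φ a + t * supNorm φ a :=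
        add_le_add (mul_le_mul_of_nonneg_left (hψ a) hs) (mul_le_mul_of_nonneg_left (hψ' a) ht)
    _ = _ := by rw [← add_mul, hst, one_mul]

lemma smul_mem_polarBall (hφ : ∀ i x, ‖φ i x‖ = 1) {u : ℂ} (hu : ‖u‖ = 1) (x : Ω) :
    (fun i => u * φ i x) ∈ polarBall φ := by
  intro a
  have e : ∑ i, a i * (u * φ i x) = u * ∑ i, a i * φ i x := by
    rw [Finset.mul_sum]
    exact Finset.sum_congr rfl fun i _ => by ring
  rw [e, norm_mul, hu, one_mul]
  exact norm_sum_le_supNorm hφ a x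

lemma norm_le_one_of_mem_polarBall [Nonempty Ω] [DecidableEq ι] (hφ : ∀ i x, ‖φ i x‖ = 1)
    {ψ : ι → ℂ} (hψ : ψ ∈ polarBall φ) (i : ι) : ‖ψ i‖ ≤ 1 := by
  have h := hψ (Pi.single i 1)
  have h1 : supNorm φ (Pi.single i 1) ≤ 1 := by
    refine csSup_le (Set.range_nonempty _) ?_
    rintro _ ⟨x, rfl⟩
    simp [Pi.single_apply, hφ]
  simp [Pi.single_apply] at h
  exact h.trans h1

lemma isCompact_polarBall [Nonempty Ω] (hφ : ∀ i x, ‖φ i x‖ = 1) : IsCompact (polarBall φ) := by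
  classical
  refine Metric.isCompact_of_isClosed_isBounded ?_ ?_
  · have : polarBall φ = ⋂ a : ι → ℂ, {ψ | ‖∑ i, a i * ψ i‖ ≤ supNorm φ a} := by
      ext ψ; simp [polarBall]
    rw [this]
    exact isClosed_iInter fun a => isClosed_le (by fun_prop) continuous_const
  · refine (Metric.isBounded_closedBall (x := (0 : ι → ℂ)) (r := 1)).subset fun ψ hψ => ?_
    rw [mem_closedBall_zero_iff, pi_norm_le_iff_of_nonneg zero_le_one]
    exact norm_le_one_of_mem_polarBall hφ hψ

/-- Duality: if the Rademacher averages of `φ` dominate `c ∑ |a_i|`, then the constant sequence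
`c` consists of first order Walsh coefficients of a function with values in the polar ball. -/
lemma exists_polarBall_walshCoeff_eq [DecidableEq ι] [Nonempty Ω] (hφ : ∀ i x, ‖φ i x‖ = 1)
    (hatt : ∀ a : ι → ℂ, ∃ x, ‖∑ i, a i * φ i x‖ = supNorm φ a) {c : ℝ} (hc : 0 ≤ c)
    (hRS : ∀ a : ι → ℂ, c * ∑ i, ‖a i‖ ≤
      𝔼 ω : ι → Bool, supNorm φ (fun i => boolSign (ω i) * a i)) :
    ∃ v : (ι → Bool) → ι → ℂ, (∀ ω, v ω ∈ polarBall φ) ∧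
      ∀ i, walshCoeff (fun ω => v ω i) {i} = c := by
  let L : ((ι → Bool) → ι → ℂ) →ₗ[ℝ] (ι → ℂ) :=
    { toFun := fun v i => walshCoeff (fun ω => v ω i) {i}
      map_add' := by
        intro v v'
        ext i
        simp only [walshCoeff, Pi.add_apply, mul_add, Finset.expect_add_distrib]
      map_smul' := by
        intro r v
        ext i
        simp only [walshCoeff, Pi.smul_apply, Complex.real_smul, RingHom.id_apply,
          Finset.mul_expect]
        refine Finset.expect_congr rfl fun ω _ => by ring }
  have hLcont : Continuous L := LinearMap.continuous_of_finiteDimensional L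
  set V : Set ((ι → Bool) → ι → ℂ) := Set.univ.pi fun _ => polarBall φ with hV
  have hVc : IsCompact V := isCompact_univ_pi fun _ => isCompact_polarBall hφ
  have hVconv : Convex ℝ V := convex_pi fun _ _ => convex_polarBall
  by_contra hcon
  have hnot : (fun _ => (c : ℂ)) ∉ L '' V := by
    rintro ⟨v, hv, hLv⟩
    exact hcon ⟨v, fun ω => hv ω (Set.mem_univ _), fun i => congrFun hLv i⟩
  obtain ⟨f, s, hf1, hf2⟩ := RCLike.geometric_hahn_banach_closed_point (𝕜 := ℂ)
    (hVconv.linear_image L) (hVc.image hLcont).isClosed hnot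
  set a : ι → ℂ := fun i => f (Pi.single i 1) with ha
  have hfa : ∀ ψ : ι → ℂ, f ψ = ∑ i, a i * ψ i := by
    intro ψ
    conv_lhs => rw [pi_eq_sum_univ' ψ]
    rw [map_sum]
    refine Finset.sum_congr rfl fun i _ => ?_
    rw [map_smul, smul_eq_mul, mul_comm]
  choose x hx using fun ω : ι → Bool => hatt (fun i => boolSign (ω i) * a i)
  choose u hu hux using fun ω : ι → Bool =>
    exists_unimodular_mul_norm (∑ i, (boolSign (ω i) * a i) * φ i (x ω))
  have hconj : ∀ ω, (starRingEnd ℂ) (u ω) * u ω = 1 := by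
    intro ω
    rw [mul_comm, Complex.mul_conj, Complex.normSq_eq_norm_sq, hu]
    norm_num
  -- The test element of V takes at ω the values of φ at a point x ω where |∑ ω_i a_i φ_i| is
  -- maximal, with the phase removed. On it the separating functional equals the Rademacher average,
  -- which by `hRS` is at least c ∑ |a_i|, contradicting the separation.
  have h1 := hf1 (L fun ω i => (starRingEnd ℂ) (u ω) * φ i (x ω)) ⟨_, fun ω _ =>
    smul_mem_polarBall hφ (by rw [RCLike.norm_conj, hu]) _, rfl⟩
  have h2 : f (L fun ω i => (starRingEnd ℂ) (u ω) * φ i (x ω)) =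
      ((𝔼 ω : ι → Bool, supNorm φ (fun i => boolSign (ω i) * a i) : ℝ) : ℂ) := by
    rw [hfa, Complex.ofReal_expect]
    simp only [L, LinearMap.coe_mk, AddHom.coe_mk, walshCoeff, Finset.prod_singleton,
      Finset.mul_expect]
    rw [← Finset.expect_sum_comm]
    refine Finset.expect_congr rfl fun ω _ => ?_
    rw [← hx ω]
    calc _ = (starRingEnd ℂ) (u ω) * ∑ i, (boolSign (ω i) * a i) * φ i (x ω) := by
          rw [Finset.mul_sum]
          exact Finset.sum_congr rfl fun i _ => by ring
      _ = _ := by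
          conv_lhs => rw [hux ω]
          linear_combination ((‖∑ i, (boolSign (ω i) * a i) * φ i (x ω)‖ : ℝ) : ℂ) * hconj ω
  rw [h2] at h1
  have h3 : RCLike.re (f fun _ => (c : ℂ)) ≤ c * ∑ i, ‖a i‖ := by
    rw [hfa, ← Finset.sum_mul]
    refine (RCLike.re_le_norm _).trans ?_
    rw [norm_mul, Complex.norm_of_nonneg hc, mul_comm]
    exact mul_le_mul_of_nonneg_left (norm_sum_le _ _) hc
  have h4 := hRS a
  have h5 : RCLike.re (((𝔼 ω : ι → Bool, supNorm φ (fun i => boolSign (ω i) * a i) : ℝ) : ℂ)) =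
    𝔼 ω : ι → Bool, supNorm φ (fun i => boolSign (ω i) * a i) := RCLike.ofReal_re (K := ℂ) _
  rw [h5] at h1
  linarith

end PolarBall

lemma expect_prod_one_add {ι : Type*} [Fintype ι] [DecidableEq ι] (θ : ι → ℝ) :
    𝔼 ω : ι → Bool, ∏ k, (1 + θ k * boolSign (ω k)) = 1 := by
  rw [Fintype.expect_eq_sum_div_card, sum_cube_prod (fun k b => 1 + θ k * boolSign b)]
  have : ∀ k, 1 + θ k * boolSign true + (1 + θ k * boolSign false) = 2 := by
    intro k; simp [boolSign]; ring
  simp_rw [this]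
  simp

/-! ### Products in the polar ball of a family of characters. -/

section Characters

variable {G : Type*} [CommGroup G] [TopologicalSpace G] {ι : Type*} [Fintype ι] [DecidableEq ι]

/-- The functions defined by a family of characters. -/
noncomputable def characterFun (χ : ι → PontryaginDual G) (i : ι) (x : G) : ℂ := (χ i x : ℂ)

variable {χ : ι → PontryaginDual G}

omit [Fintype ι] [DecidableEq ι] in
lemma norm_characterFun (i : ι) (x : G) : ‖characterFun χ i x‖ = 1 := Circle.norm_coe _

omit [Fintype ι] [DecidableEq ι] in
lemma characterFun_mul (i : ι) (x y : G) : characterFun χ i (x * y) = characterFun χ i x * characterFun χ i y := by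
  simp [characterFun]

omit [Fintype ι] [DecidableEq ι] in
lemma continuous_characterFun (i : ι) : Continuous (characterFun χ i) :=
  continuous_subtype_val.comp (χ i).continuous_toFun

-- Multiplying the coefficients by the χ_i(y) translates the sum by y.
omit [DecidableEq ι] in
lemma supNorm_mul_characterFun_le (a : ι → ℂ) (y : G) :
    supNorm (characterFun χ) (fun i => a i * characterFun χ i y) ≤ supNorm (characterFun χ) a := by
  refine csSup_le (Set.range_nonempty _) ?_
  rintro _ ⟨x, rfl⟩
  have h := norm_sum_le_supNorm (norm_characterFun (χ := χ)) a (y * x)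
  simp only [characterFun_mul, ← mul_assoc] at h
  exact h

-- Members of the polar ball behave like Fourier–Stieltjes coefficients of measures of mass at most
-- one, and the product like convolution: ψ' is tested on a ψ, then ψ on the translates of a.
omit [DecidableEq ι] in
lemma mul_mem_polarBall {ψ ψ' : ι → ℂ} (hψ : ψ ∈ polarBall (characterFun χ))
    (hψ' : ψ' ∈ polarBall (characterFun χ)) : ψ * ψ' ∈ polarBall (characterFun χ) := by
  intro a
  have h1 := hψ' (fun i => a i * ψ i)
  have h2 : supNorm (characterFun χ) (fun i => a i * ψ i) ≤ supNorm (characterFun χ) a := by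
    refine csSup_le (Set.range_nonempty _) ?_
    rintro _ ⟨x, rfl⟩
    have h := (hψ (fun i => a i * characterFun χ i x)).trans (supNorm_mul_characterFun_le a x)
    simp only at h ⊢
    convert h using 3
    ring
  simp only [Pi.mul_apply, ← mul_assoc]
  exact h1.trans h2

/-- The average of the products `v ω * v ω'` against a Riesz kernel. -/
noncomputable def rieszConv (v : (ι → Bool) → ι → ℂ) (r : ι → ℝ) (m : ι) : ℂ :=
  𝔼 ω : ι → Bool, 𝔼 ω' : ι → Bool,
    (∏ k, (1 + (r k : ℂ) * (boolSign (ω k) * boolSign (ω' k)))) * (v ω m * v ω' m)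

lemma rieszConv_mem_polarBall {v : (ι → Bool) → ι → ℂ}
    (hv : ∀ ω, v ω ∈ polarBall (characterFun χ)) {r : ι → ℝ} (hr : ∀ k, |r k| ≤ 1) :
    rieszConv v r ∈ polarBall (characterFun χ) := by
  intro a
  have e : ∑ m, a m * rieszConv v r m = 𝔼 ω : ι → Bool, 𝔼 ω' : ι → Bool,
      (∏ k, (1 + (r k : ℂ) * (boolSign (ω k) * boolSign (ω' k)))) *
        ∑ m, a m * (v ω * v ω') m := by
    unfold rieszConv
    simp_rw [Finset.mul_expect, ← Finset.expect_sum_comm, Finset.mul_sum, Pi.mul_apply]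
    refine Finset.expect_congr rfl fun ω _ => Finset.expect_congr rfl fun ω' _ =>
      Finset.sum_congr rfl fun m _ => by ring
  have hker : ∀ ω ω' : ι → Bool,
      ‖∏ k, (1 + (r k : ℂ) * (boolSign (ω k) * boolSign (ω' k)))‖ =
        ∏ k, (1 + r k * boolSign (ω k) * boolSign (ω' k)) := by
    intro ω ω'
    rw [norm_prod]
    refine Finset.prod_congr rfl fun k _ => ?_
    have h1 : (1 + (r k : ℂ) * (boolSign (ω k) * boolSign (ω' k))) =
        ((1 + r k * boolSign (ω k) * boolSign (ω' k) : ℝ) : ℂ) := by push_cast; ring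
    rw [h1, Complex.norm_of_nonneg]
    have h2 := abs_le.1 (hr k)
    rcases boolSign_eq_or (ω k) with h | h <;> rcases boolSign_eq_or (ω' k) with h' | h' <;>
      rw [h, h'] <;> linarith [h2.1, h2.2]
  rw [e]
  calc _ ≤ 𝔼 ω : ι → Bool, 𝔼 ω' : ι → Bool,
        (∏ k, (1 + r k * boolSign (ω k) * boolSign (ω' k))) * supNorm (characterFun χ) a := by
        refine (RCLike.norm_expect_le (K := ℂ)).trans (Finset.expect_le_expect fun ω _ => ?_)
        refine (RCLike.norm_expect_le (K := ℂ)).trans (Finset.expect_le_expect fun ω' _ => ?_)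
        rw [norm_mul, ← hker]
        exact mul_le_mul_of_nonneg_left (mul_mem_polarBall (hv ω) (hv ω') a) (norm_nonneg _)
    _ = _ := by
        simp_rw [← Finset.expect_mul,
          fun ω : ι → Bool => expect_prod_one_add (fun k => r k * boolSign (ω k))]
        rw [Fintype.expect_const, one_mul]

/-- The polar ball contains, up to an error of second order in `ρ`, the sequences
`ρ / 2 * ∑ k, τ k * (walshCoeff (v · m) {k}) ^ 2`. -/
lemma exists_approx_mem_polarBall {v : (ι → Bool) → ι → ℂ}
    (hv : ∀ ω, v ω ∈ polarBall (characterFun χ)) {ρ : ℝ} (hρ : 0 ≤ ρ) (hρ1 : ρ ≤ 1) {τ : ι → ℂ}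
    (hτ : ∀ k, ‖τ k‖ ≤ 1) :
    ∃ ψ ∈ polarBall (characterFun χ), ∀ m,
      ‖ψ m - ρ / 2 * ∑ k, τ k * walshCoeff (fun ω => v ω m) {k} ^ 2‖ ≤ ρ ^ 2 := by
  have hre : ∀ k, |(τ k).re| ≤ 1 := fun k => (Complex.abs_re_le_norm _).trans (hτ k)
  have him : ∀ k, |(τ k).im| ≤ 1 := fun k => (Complex.abs_im_le_norm _).trans (hτ k)
  have hρabs : ∀ t : ℝ, |t| ≤ 1 → |ρ * t| ≤ ρ := fun t ht => by
    rw [abs_mul, abs_of_nonneg hρ]; exact mul_le_of_le_one_right hρ ht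
  -- Only real multipliers in [-1, 1] keep the kernel nonnegative. Complex τ is recovered from four
  -- kernels with weights 1, -i, -1, i: the weights sum to zero, which removes S = ∅, and on a
  -- singleton {k} the average is ρ τ_k / 2.
  set r : Fin 4 → ι → ℝ := ![fun k => ρ * (τ k).re, fun k => ρ * -(τ k).im,
    fun k => ρ * -(τ k).re, fun k => ρ * (τ k).im] with hr
  have hrle : ∀ i k, |r i k| ≤ ρ := by
    intro i k
    fin_cases i
    · exact hρabs _ (hre k)
    · exact hρabs _ (by rw [abs_neg]; exact him k)
    · exact hρabs _ (by rw [abs_neg]; exact hre k)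
    · exact hρabs _ (him k)
  have hP : ∀ i, rieszConv v (r i) ∈ polarBall (characterFun χ) := fun i =>
    rieszConv_mem_polarBall hv fun k => (hrle i k).trans hρ1
  set ε : Fin 4 → ℂ := ![1, -Complex.I, -1, Complex.I] with hε
  have hεn : ∀ i, ‖ε i‖ = 1 := by
    intro i
    fin_cases i <;> simp [hε]
  refine ⟨fun m => (∑ i, ε i * rieszConv v (r i) m) / 4, ?_, ?_⟩
  · intro a
    have e : ∑ m, a m * ((∑ i, ε i * rieszConv v (r i) m) / 4) =
        (∑ i, ε i * ∑ m, a m * rieszConv v (r i) m) / 4 := by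
      simp_rw [Finset.mul_sum, Finset.sum_div, Finset.mul_sum]
      rw [Finset.sum_comm]
      exact Finset.sum_congr rfl fun i _ => Finset.sum_congr rfl fun m _ => by ring
    rw [e, norm_div, Complex.norm_ofNat, div_le_iff₀ (by norm_num)]
    calc _ ≤ ∑ i : Fin 4, supNorm (characterFun χ) a := by
          refine (norm_sum_le _ _).trans (Finset.sum_le_sum fun i _ => ?_)
          rw [norm_mul, hεn, one_mul]
          exact hP i a
      _ = _ := by simp; ring
  · intro m
    set w : Finset ι → ℂ := fun S => walshCoeff (fun ω => v ω m) S with hw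
    set q : Finset ι → ℂ := fun S => (∑ i, ε i * ∏ k ∈ S, (r i k : ℂ)) / 4 with hq
    have e1 : (∑ i, ε i * rieszConv v (r i) m) / 4 = ∑ S, q S * w S ^ 2 := by
      have : ∀ i, rieszConv v (r i) m = ∑ S : Finset ι, (∏ k ∈ S, (r i k : ℂ)) * w S ^ 2 := by
        intro i
        have h := expect_expect_riesz (fun k => (r i k : ℂ)) (fun ω => v ω m) (fun ω => v ω m)
        simp_rw [← sq] at h
        rw [hw, ← h]
        rfl
      simp_rw [this, hq, Finset.mul_sum]
      rw [Finset.sum_comm, Finset.sum_div]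
      refine Finset.sum_congr rfl fun S _ => ?_
      rw [div_mul_eq_mul_div, Finset.sum_mul]
      congr 1
      exact Finset.sum_congr rfl fun i _ => by ring
    have hq1 : ∀ k, q {k} = ρ / 2 * τ k := by
      intro k
      have h : (τ k : ℂ) = (τ k).re + (τ k).im * Complex.I := (Complex.re_add_im _).symm
      simp only [hq, hε, hr, Finset.prod_singleton, Fin.sum_univ_four, Matrix.cons_val_zero,
        Matrix.cons_val_one, Matrix.cons_val]
      simp
      linear_combination (-(ρ : ℂ) / 2) * h
    have hq0 : q ∅ = 0 := by
      simp [hq, hε, Fin.sum_univ_four]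
    have hq2 : ∀ S : Finset ι, S.card ≠ 1 → ‖q S‖ ≤ ρ ^ 2 := by
      intro S hS
      rcases Nat.eq_zero_or_pos S.card with h0 | h0
      · rw [Finset.card_eq_zero.1 h0, hq0, norm_zero]; positivity
      · rw [hq, norm_div, Complex.norm_ofNat, div_le_iff₀ (by norm_num)]
        calc _ ≤ ∑ i : Fin 4, ρ ^ 2 := by
              refine (norm_sum_le _ _).trans (Finset.sum_le_sum fun i _ => ?_)
              rw [norm_mul, hεn, one_mul, norm_prod]
              calc _ ≤ ∏ k ∈ S, ρ := Finset.prod_le_prod (fun _ _ => norm_nonneg _) fun k _ => by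
                    rw [Complex.norm_real]; exact hrle i k
                _ = ρ ^ S.card := Finset.prod_const _
                _ ≤ ρ ^ 2 := pow_le_pow_of_le_one hρ hρ1 (by omega)
          _ = _ := by simp; ring
    have e2 : (ρ / 2 * ∑ k, τ k * w {k} ^ 2 : ℂ) =
        ∑ S : Finset ι, if S.card = 1 then q S * w S ^ 2 else 0 := by
      rw [← Finset.sum_filter]
      have : (Finset.univ.filter fun S : Finset ι => S.card = 1) =
          Finset.univ.image (fun k : ι => ({k} : Finset ι)) := by
        ext S
        simp [Finset.card_eq_one, eq_comm]
      rw [this, Finset.sum_image fun _ _ _ _ h => Finset.singleton_injective h, Finset.mul_sum]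
      refine Finset.sum_congr rfl fun k _ => ?_
      rw [hq1]; ring
    change ‖(∑ i, ε i * rieszConv v (r i) m) / 4 - ρ / 2 * ∑ k, τ k * w {k} ^ 2‖ ≤ ρ ^ 2
    rw [e1, e2, ← Finset.sum_sub_distrib]
    calc _ ≤ ∑ S, ρ ^ 2 * ‖w S‖ ^ 2 := by
          refine (norm_sum_le _ _).trans (Finset.sum_le_sum fun S _ => ?_)
          split_ifs with h
          · rw [sub_self, norm_zero]; positivity
          · rw [sub_zero, norm_mul, norm_pow]
            exact mul_le_mul_of_nonneg_right (hq2 S h) (by positivity)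
      _ = ρ ^ 2 * ∑ S, ‖w S‖ ^ 2 := (Finset.mul_sum _ _ _).symm
      _ ≤ ρ ^ 2 * 1 := mul_le_mul_of_nonneg_left (sum_norm_sq_walshCoeff_le _ fun ω =>
          norm_le_one_of_mem_polarBall norm_characterFun (hv ω) m) (by positivity)
      _ = _ := mul_one _

end Characters

/-! ### Rider's theorem on a compact abelian group. -/

section Haar

variable {G : Type*} [CommGroup G] [TopologicalSpace G] [IsTopologicalGroup G] [CompactSpace G]
  [MeasurableSpace G] [BorelSpace G]

omit [CompactSpace G] in
lemma integral_characterFun_mul_conj (μ : Measure G) [μ.IsHaarMeasure] [IsProbabilityMeasure μ]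
    {ι : Type*} [DecidableEq ι] {χ : ι → PontryaginDual G} (hχ : Function.Injective χ) (m k : ι) :
    ∫ y, characterFun χ m y * (starRingEnd ℂ) (characterFun χ k y) ∂μ = if k = m then 1 else 0 := by
  split_ifs with h
  · subst h
    have : ∀ y, characterFun χ k y * (starRingEnd ℂ) (characterFun χ k y) = 1 := by
      intro y
      rw [Complex.mul_conj, Complex.normSq_eq_norm_sq, norm_characterFun]
      norm_num
    simp_rw [this]
    simp
  · have hne : χ k ≠ χ m := fun e => h (hχ e)
    obtain ⟨g, hg⟩ := DFunLike.ne_iff.1 hne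
    set F : G → ℂ := fun y => characterFun χ m y * (starRingEnd ℂ) (characterFun χ k y) with hF
    have h1 : ∫ y, F (g * y) ∂μ = ∫ y, F y ∂μ := integral_mul_left_eq_self F g
    have h2 : ∀ y, F (g * y) = F g * F y := by
      intro y
      simp only [hF, characterFun_mul, map_mul]
      ring
    simp_rw [h2] at h1
    rw [integral_const_mul] at h1
    have h3 : F g ≠ 1 := by
      intro h3
      apply hg
      have h4 : characterFun χ m g = characterFun χ k g := by
        calc characterFun χ m g = characterFun χ m g *
              ((starRingEnd ℂ) (characterFun χ k g) * characterFun χ k g) := by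
              rw [mul_comm ((starRingEnd ℂ) _), Complex.mul_conj, Complex.normSq_eq_norm_sq,
                norm_characterFun]
              norm_num
          _ = F g * characterFun χ k g := by simp only [hF]; ring
          _ = _ := by rw [h3, one_mul]
      exact (Circle.coe_injective h4).symm
    have h5 : (F g - 1) * ∫ y, F y ∂μ = 0 := by rw [sub_mul, one_mul, h1, sub_self]
    exact (mul_eq_zero.1 h5).resolve_left (sub_ne_zero.2 h3)

/-- Rider's theorem: the Rademacher–Sidon property implies the Sidon property. -/
theorem sum_norm_le_supNorm_of_expect (μ : Measure G) [μ.IsHaarMeasure] [IsProbabilityMeasure μ]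
    {ι : Type*} [Fintype ι] [DecidableEq ι] {χ : ι → PontryaginDual G}
    (hχ : Function.Injective χ) {c : ℝ} (hc : 0 ≤ c) (hc1 : c ≤ 1)
    (hRS : ∀ a : ι → ℂ, c * ∑ i, ‖a i‖ ≤
      𝔼 ω : ι → Bool, supNorm (characterFun χ) (fun i => boolSign (ω i) * a i)) (a : ι → ℂ) :
    c ^ 4 / 16 * ∑ i, ‖a i‖ ≤ supNorm (characterFun χ) a := by
  have hatt : ∀ a : ι → ℂ, ∃ x, ‖∑ i, a i * characterFun χ i x‖ = supNorm (characterFun χ) a := by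
    intro a
    have hcont : Continuous fun x => ‖∑ i, a i * characterFun χ i x‖ :=
      (continuous_finsetSum _ fun i _ => continuous_const.mul (continuous_characterFun i)).norm
    exact (isCompact_range hcont).sSup_mem (Set.range_nonempty _)
  obtain ⟨v, hv, hvc⟩ := exists_polarBall_walshCoeff_eq norm_characterFun hatt hc hRS
  choose u hu hau using fun i => exists_unimodular_mul_norm (a i)
  -- This maximizes ρ c² / 2 - ρ², with value c⁴ / 16.
  set ρ := c ^ 2 / 4 with hρ
  have hρ0 : 0 ≤ ρ := by positivity
  have hρ1 : ρ ≤ 1 := by nlinarith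
  -- The conjugate of χ_k(y), paired with χ_m(y) and integrated in y, keeps only k = m, where the
  -- Walsh coefficient is c. The conjugate of u_k aligns the phase of a_k.
  set τ : G → ι → ℂ := fun y k => (starRingEnd ℂ) (u k) * (starRingEnd ℂ) (characterFun χ k y) with hτ
  have hτ1 : ∀ y k, ‖τ y k‖ ≤ 1 := by
    intro y k
    rw [hτ, norm_mul, RCLike.norm_conj, RCLike.norm_conj, hu, norm_characterFun, one_mul]
  set w : ι → ι → ℂ := fun m k => walshCoeff (fun ω => v ω m) {k} with hw
  set M : G → ℂ := fun y => ∑ m, a m * characterFun χ m y * (ρ / 2 * ∑ k, τ y k * w m k ^ 2) with hM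
  have hMle : ∀ y, ‖M y‖ ≤ supNorm (characterFun χ) a + ρ ^ 2 * ∑ i, ‖a i‖ := by
    intro y
    obtain ⟨ψ, hψ, hψm⟩ := exists_approx_mem_polarBall hv hρ0 hρ1 (hτ1 y)
    have e : M y = ∑ m, a m * characterFun χ m y * ψ m - ∑ m, a m * characterFun χ m y *
        (ψ m - ρ / 2 * ∑ k, τ y k * w m k ^ 2) := by
      rw [← Finset.sum_sub_distrib]
      exact Finset.sum_congr rfl fun m _ => by ring
    rw [e]
    refine (norm_sub_le _ _).trans (add_le_add ?_ ?_)
    · exact (hψ (fun m => a m * characterFun χ m y)).trans (supNorm_mul_characterFun_le a y)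
    · rw [Finset.mul_sum]
      refine (norm_sum_le _ _).trans (Finset.sum_le_sum fun m _ => ?_)
      rw [norm_mul, norm_mul, norm_characterFun, mul_one, mul_comm]
      exact mul_le_mul_of_nonneg_right (hψm m) (norm_nonneg _)
  have hint : ∫ y, M y ∂μ = ρ / 2 * c ^ 2 * ∑ i, (‖a i‖ : ℂ) := by
    have hterm : ∀ m k, Integrable
        (fun y => characterFun χ m y * (starRingEnd ℂ) (characterFun χ k y)) μ := by
      intro m k
      have hcont : Continuous fun y => characterFun χ m y * (starRingEnd ℂ) (characterFun χ k y) :=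
        (continuous_characterFun m).mul (Complex.continuous_conj.comp (continuous_characterFun k))
      refine Integrable.of_bound hcont.aestronglyMeasurable 1
        (Filter.Eventually.of_forall fun y => ?_)
      rw [norm_mul, RCLike.norm_conj, norm_characterFun, norm_characterFun, one_mul]
    have e : ∀ y, M y = ∑ m, ∑ k, (a m * (ρ / 2) * (starRingEnd ℂ) (u k) * w m k ^ 2) *
        (characterFun χ m y * (starRingEnd ℂ) (characterFun χ k y)) := by
      intro y
      simp only [hM, hτ, Finset.mul_sum]
      exact Finset.sum_congr rfl fun m _ => Finset.sum_congr rfl fun k _ => by ring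
    simp_rw [e]
    rw [integral_finsetSum _ fun m _ => integrable_finsetSum _ fun k _ =>
      (hterm m k).const_mul _, Finset.mul_sum]
    refine Finset.sum_congr rfl fun m _ => ?_
    rw [integral_finsetSum _ fun k _ => (hterm m k).const_mul _]
    simp_rw [integral_const_mul, integral_characterFun_mul_conj μ hχ, mul_ite, mul_one, mul_zero]
    rw [Finset.sum_ite_eq' Finset.univ m, if_pos (Finset.mem_univ _)]
    have hwm : w m m = c := hvc m
    have huu : u m * (starRingEnd ℂ) (u m) = 1 := by
      rw [Complex.mul_conj, Complex.normSq_eq_norm_sq, hu]; norm_num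
    rw [hwm]
    calc _ = ‖a m‖ * (u m * (starRingEnd ℂ) (u m)) * (ρ / 2) * c ^ 2 := by
          conv_lhs => rw [hau m]
          ring
      _ = _ := by rw [huu]; ring
  have hnorm := norm_integral_le_of_norm_le_const (μ := μ) (Filter.Eventually.of_forall hMle)
  rw [hint, probReal_univ, mul_one, ← Complex.ofReal_sum] at hnorm
  have e : (ρ / 2 * c ^ 2 * ((∑ i, ‖a i‖ : ℝ) : ℂ) : ℂ) =
      ((ρ / 2 * c ^ 2 * ∑ i, ‖a i‖ : ℝ) : ℂ) := by push_cast; ring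
  have hs0 : 0 ≤ ∑ i, ‖a i‖ := Finset.sum_nonneg fun i _ => norm_nonneg _
  rw [e, Complex.norm_of_nonneg (by positivity)] at hnorm
  have e2 : c ^ 4 / 16 * ∑ i, ‖a i‖ = ρ / 2 * c ^ 2 * ∑ i, ‖a i‖ - ρ ^ 2 * ∑ i, ‖a i‖ := by
    rw [hρ]; ring
  linarith

/-- A set of characters with a subgaussian moment generating function is a Sidon set. -/
lemma sidonWith_of_integral_exp_le (μ : Measure G) [μ.IsHaarMeasure] [IsProbabilityMeasure μ]
    (Λ : Set (PontryaginDual G)) {D : ℝ} (hD : 1 ≤ D)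
    (hmgf : ∀ (T : Finset Λ) (c : Λ → ℂ), ∫ x, Real.exp (∑ i ∈ T, c i * characterSystem Λ i x).re ∂μ
      ≤ 2 * Real.exp (D * ∑ i ∈ T, ‖c i‖ ^ 2)) {R : ℕ} (hR : 2000 * D + 1 ≤ R) :
    SidonWith (characterSystem Λ) ((R * (1 + 1200 * D))⁻¹ ^ 4 / 16) := by
  classical
  intro s a
  set χ : s → PontryaginDual G := fun i => ((i : Λ) : PontryaginDual G) with hχ
  have hχinj : Function.Injective χ := Subtype.val_injective.comp Subtype.val_injective
  have hR0 : (1 : ℝ) ≤ R := by linarith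
  have hK1 : 1 ≤ R * (1 + 1200 * D) := by nlinarith
  have hmgf' : ∀ (T : Finset s) (c : s → ℂ), ∫ x, Real.exp (∑ i ∈ T, c i * characterFun χ i x).re ∂μ
      ≤ 2 * Real.exp (D * ∑ i ∈ T, ‖c i‖ ^ 2) := by
    intro T c
    have h := hmgf (T.map (Function.Embedding.subtype _))
      (fun j => if h : j ∈ s then c ⟨j, h⟩ else 0)
    simp only [Finset.sum_map, Function.Embedding.subtype_apply, Finset.coe_mem, dif_pos,
      Subtype.coe_eta] at h
    exact h
  have hRS : ∀ a : s → ℂ, (R * (1 + 1200 * D))⁻¹ * ∑ i, ‖a i‖ ≤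
      𝔼 ω : s → Bool, supNorm (characterFun χ) (fun i => boolSign (ω i) * a i) := by
    intro a
    rw [inv_mul_le_iff₀ (by linarith)]
    exact sum_norm_le_expect_supNorm μ (fun i => (continuous_characterFun i).measurable)
      norm_characterFun hD hmgf' hR a
  have hS := sum_norm_le_supNorm_of_expect μ hχinj (by positivity) (inv_le_one_of_one_le₀ hK1) hRS
    (fun i => a i)
  have e1 : ∑ i : s, ‖a i‖ = ∑ j ∈ s, ‖a j‖ := Finset.sum_coe_sort s (fun j => ‖a j‖)
  rw [e1] at hS
  refine (ENNReal.ofReal_le_ofReal hS).trans ?_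
  have hcont : Continuous fun x => ‖∑ i : s, a i * characterFun χ i x‖ :=
    (continuous_finsetSum _ fun i _ => continuous_const.mul (continuous_characterFun i)).norm
  obtain ⟨x, hx⟩ := (isCompact_range hcont).sSup_mem (Set.range_nonempty _)
  refine le_trans (le_of_eq ?_) (le_iSup _ x)
  rw [supNorm, ← hx]
  simp only
  rw [ofReal_norm]
  congr 1
  exact Finset.sum_coe_sort s (fun j => a j * characterSystem Λ j x)

end Haar

theorem mainTheorem2 (C : ℝ) :
    ∃ γ : ℝ, 0 < γ ∧
      ∀ (G : Type*) [CommGroup G] [TopologicalSpace G] [IsTopologicalGroup G] [CompactSpace G]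
        [MeasurableSpace G] [BorelSpace G] (μ : Measure G) [μ.IsHaarMeasure]
        [IsProbabilityMeasure μ] (Λ : Set (PontryaginDual G)),
        (Psi2Condition (characterSystem Λ) μ C → SidonWith (characterSystem Λ) γ) ∧
        (RudinCondition (characterSystem Λ) μ C → SidonWith (characterSystem Λ) γ) := by
  -- Enlarging C makes D = (6 C')² / 4 at least 1, as the block argument requires, and allows any
  -- real C.
  set C' := max C 1 with hC'
  have hCC' : C ≤ C' := le_max_left _ _
  have hC1 : 1 ≤ C' := le_max_right _ _
  have hC0 : 0 < C' := by linarith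
  obtain ⟨R, hR⟩ := exists_nat_ge (2000 * ((6 * C') ^ 2 / 4) + 1)
  have hR0 : (0 : ℝ) < R := lt_of_lt_of_le (by positivity) hR
  refine ⟨(R * (1 + 1200 * ((6 * C') ^ 2 / 4)))⁻¹ ^ 4 / 16, by positivity, ?_⟩
  intro G _ _ _ _ _ _ μ _ _ Λ
  have hm : ∀ i, Measurable (characterSystem Λ i) := fun i =>
    (continuous_characterFun (χ := fun i : Λ => (i : PontryaginDual G)) i).measurable
  have hn : ∀ i x, ‖characterSystem Λ i x‖ = 1 := fun i x => Circle.norm_coe _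
  have hD : 1 ≤ (6 * C') ^ 2 / 4 := by nlinarith
  refine ⟨fun h => ?_, fun h => ?_⟩
  · exact sidonWith_of_integral_exp_le μ Λ hD (fun T c =>
      integral_exp_re_le_of_exp_sq hm hn (by positivity) T c
        ((h.mono hCC').integral_exp_sq_le hC0 hm hn T c)) hR
  · exact sidonWith_of_integral_exp_le μ Λ hD (fun T c =>
      integral_exp_re_le_of_exp_sq hm hn (by positivity) T c
        ((h.mono hCC').integral_exp_sq_le hC0 hm hn T c)) hR
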